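/- Let $G$ be any group. For $n\ge 0$ let $\Sigma_n$ be the symmetric group on $\{1,\dots,n\}$, and let $G\wr\Sigma_n=G^n\rtimes\Sigma_n$ be the wreath product, where $\Sigma_n$ acts on $G^n$ by permuting the coordinates. Let $\iota_n\colon G\wr\Sigma_n\to G\wr\Sigma_{n+1}$ be the inclusion $(g_1,\dots,g_n;\sigma)\mapsto(g_1,\dots,g_n,1;\sigma)$, where on the right $\sigma$ is extended by $\sigma(n+1)=n+1$. Then for all integers $n,i\ge 0$ the induced homomorphism on integral group homology $$(\iota_n)_*\colon H_i(G\wr\Sigma_n;\mathbb Z)\to H_i(G\wr\Sigma_{n+1};\mathbb Z)$$ (trivial coefficients $\mathbb Z$) is an isomorphism if $n\ge 2i+1$, and is surjective if $n=2i$. -/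

import Mathlib

open CategoryTheory

/-- The wreath product `G ≀ Σ_n`: the semidirect product `G^n ⋊ Σ_n`, where a permutation `σ`
of `{0, …, n-1}` acts on `G^n` by permuting the coordinates, `(σ • f) i = f (σ⁻¹ i)`. -/
abbrev SymWreath (G : Type*) [Group G] (n : ℕ) : Type _ :=
  SemidirectProduct (Fin n → G) (Equiv.Perm (Fin n))
    (mulAutArrow (G := Equiv.Perm (Fin n)) (A := Fin n) (M := G))

namespace SymWreath

/-- The inclusion `G^n → G^(n+1)` that appends the identity as the last coordinate. -/
def baseInclusion (G : Type*) [Group G] (n : ℕ) : (Fin n → G) →* (Fin (n + 1) → G) where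
  toFun f := Fin.snoc (α := fun _ => G) f 1
  map_one' := by
    ext i
    refine Fin.lastCases ?_ (fun j => ?_) i <;> simp
  map_mul' f g := by
    ext i
    refine Fin.lastCases ?_ (fun j => ?_) i <;> simp

/-- The inclusion `Σ_n → Σ_(n+1)` of the permutations that fix the last point. -/
noncomputable def permInclusion (n : ℕ) : Equiv.Perm (Fin n) →* Equiv.Perm (Fin (n + 1)) :=
  Equiv.Perm.viaEmbeddingHom (Fin.castSuccEmb (n := n))

theorem permInclusion_castSucc (n : ℕ) (σ : Equiv.Perm (Fin n)) (i : Fin n) :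
    permInclusion n σ i.castSucc = (σ i).castSucc :=
  Equiv.Perm.viaEmbedding_apply σ (Fin.castSuccEmb (n := n)) i

theorem permInclusion_last (n : ℕ) (σ : Equiv.Perm (Fin n)) :
    permInclusion n σ (Fin.last n) = Fin.last n :=
  Equiv.Perm.viaEmbedding_apply_of_notMem σ (Fin.castSuccEmb (n := n)) _ (by simp)

/-- The inclusion `G ≀ Σ_n → G ≀ Σ_(n+1)`,
`(g_1, …, g_n; σ) ↦ (g_1, …, g_n, 1; σ)`, where `σ` is extended by fixing the last point. -/
noncomputable def inclusion (G : Type*) [Group G] (n : ℕ) :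
    SymWreath G n →* SymWreath G (n + 1) :=
  SemidirectProduct.map (baseInclusion G n) (permInclusion n) (by
    intro σ
    ext f i
    change (Fin.snoc (α := fun _ => G) (fun j => f (σ⁻¹ j)) 1 : Fin (n + 1) → G) i =
      (Fin.snoc (α := fun _ => G) f 1 : Fin (n + 1) → G) ((permInclusion n σ)⁻¹ i)
    rw [← map_inv]
    refine Fin.lastCases ?_ (fun j => ?_) i
    · rw [permInclusion_last, Fin.snoc_last, Fin.snoc_last]
    · rw [permInclusion_castSucc, Fin.snoc_castSucc, Fin.snoc_castSucc])

theorem inclusion_left_castSucc (G : Type*) [Group G] (n : ℕ) (x : SymWreath G n) (j : Fin n) :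
    (inclusion G n x).left j.castSucc = x.left j :=
  Fin.snoc_castSucc (α := fun _ => G) 1 x.left j

theorem inclusion_left_last (G : Type*) [Group G] (n : ℕ) (x : SymWreath G n) :
    (inclusion G n x).left (Fin.last n) = 1 :=
  Fin.snoc_last (α := fun _ => G) 1 x.left

theorem inclusion_right (G : Type*) [Group G] (n : ℕ) (x : SymWreath G n) :
    (inclusion G n x).right = permInclusion n x.right := rfl

end SymWreath

universe u

/-- The integral homology `H_i(G) = H_i(G; ℤ)` of a group, with untwisted coefficients.
The integers are lifted to the universe of `G`, as required by Mathlib's `groupHomology`. -/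
noncomputable abbrev integralHomology (G : Type u) [Group G] (i : ℕ) : ModuleCat (ULift.{u} ℤ) :=
  groupHomology (Rep.trivial (ULift.{u} ℤ) G (ULift.{u} ℤ)) i

/-- The homomorphism `H_i(G) → H_i(H)` induced by a group homomorphism `f : G → H`
and the identity on the coefficients. -/
noncomputable def integralHomologyMap {G H : Type u} [Group G] [Group H] (f : G →* H) (i : ℕ) :
    integralHomology G i ⟶ integralHomology H i :=
  groupHomology.map (A := Rep.trivial (ULift.{u} ℤ) G (ULift.{u} ℤ))
    (B := Rep.trivial (ULift.{u} ℤ) H (ULift.{u} ℤ)) f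
    (𝟙 (Rep.trivial (ULift.{u} ℤ) G (ULift.{u} ℤ))) i

/-! Stability is proved by letting `G ≀ Σ_N` act on the augmented complex of injective words: words
in letters `(i, g)` with `i < N` and `g : G` whose underlying letters `i` are distinct, with the
alternating sum of letter deletions as differential. Three facts carry the argument.

The complex is exact in lengths below `N` (`InjectiveWords.exists_boundary_eq`). An explicit
contraction is built by induction on the alphabet: a chosen letter `s` is pushed to the front of
every word and removed, after which prepending `s` is a cone.

Words of length `ℓ` form one orbit, and the stabilizer of a standard word is `G ≀ Σ_(N-ℓ)`. By
Shapiro's lemma (`isIso_map_singleHom`), the homology of `G ≀ Σ_N` with coefficients in the chains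
`C_ℓ` is that of `G ≀ Σ_(N-ℓ)`. Any two faces of the standard word differ by an element commuting
with the stabilizer of the whole word, and inner automorphisms act trivially on homology
(`map_conj`), so all `ℓ + 1` faces induce the stabilization map. Their alternating sum `D_ℓ :
C_(ℓ+1) ⟶ C_ℓ` therefore induces stabilization for even `ℓ` and zero for odd `ℓ`
(`shapiroMap_comp_wordD`).

The usual spectral sequence is replaced by the long exact sequences of `im D_(ℓ+1) ⟶ C_(ℓ+1) ⟶ im
D_ℓ`. With `N = n + 1`, the map `D_0` is the stabilization from `n` to `n + 1`, and the even `D_ℓ`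
are earlier stabilizations, known in lower homological degrees by induction (`epi_map_zero`,
`mono_map_zero`). -/

namespace InjectiveWords

/-! ### Exactness of the complex of injective words. -/

variable {α : Type*} (k : Type*) [CommRing k]

/-- Prepend the letter `a` to every word of a chain of words. -/
noncomputable def consMap (a : α) : (List α →₀ k) →ₗ[k] (List α →₀ k) :=
  Finsupp.lmapDomain k k (List.cons a)

@[simp]
theorem consMap_single (a : α) (w : List α) (r : k) :
    consMap k a (Finsupp.single w r) = Finsupp.single (a :: w) r := by
  simp [consMap]

/-- The boundary of a word. -/
noncomputable def boundaryWord : List α → (List α →₀ k)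
  | [] => 0
  | a :: w => Finsupp.single w 1 - consMap k a (boundaryWord w)

/-- The alternating sum of the letter-deleting maps, on chains of words. -/
noncomputable def boundary : (List α →₀ k) →ₗ[k] (List α →₀ k) :=
  Finsupp.linearCombination k (boundaryWord k)

@[simp]
theorem boundary_single (w : List α) (r : k) :
    boundary k (Finsupp.single w r) = r • boundaryWord k w := by
  simp [boundary]

/-- Prepending a letter contracts the complex of all words. It does not preserve injective words,
which is why a subtler contraction is needed below. -/
theorem boundary_consMap (a : α) (z : List α →₀ k) :
    boundary k (consMap k a z) = z - consMap k a (boundary k z) := by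
  induction z using Finsupp.induction_linear with
  | zero => simp
  | add x y hx hy => simp only [map_add, hx, hy]; abel
  | single w r => simp [boundaryWord, smul_sub]

theorem boundary_boundary (z : List α →₀ k) : boundary k (boundary k z) = 0 := by
  have key : ∀ w : List α, boundary k (boundaryWord k w) = 0 := by
    intro w
    induction w with
    | nil => simp [boundaryWord]
    | cons a w ih => simp [boundaryWord, boundary_consMap, ih]
  induction z using Finsupp.induction_linear with
  | zero => simp
  | add x y hx hy => simp only [map_add, hx, hy, add_zero]
  | single w r => simp [key]

/-- The recursive form suits the contraction; this closed form matches the sum of face maps in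
`wordD`. -/
theorem boundaryWord_eq_sum (w : List α) :
    boundaryWord k w =
      ∑ i ∈ Finset.range w.length, Finsupp.single (w.eraseIdx i) ((-1 : k) ^ i) := by
  induction w with
  | nil => simp [boundaryWord]
  | cons a w ih =>
    rw [boundaryWord, ih, List.length_cons, Finset.sum_range_succ', map_sum, add_comm,
      sub_eq_add_neg, ← Finset.sum_neg_distrib]
    simp [pow_succ]

section Contraction

variable {S L : Type*}

/-- Words with letters labelled by `L` whose underlying letters are distinct and lie in `T`. -/
def IsInjectiveOver (T : Finset S) (w : List (S × L)) : Prop :=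
  (w.map Prod.fst).Nodup ∧ ∀ a ∈ w, a.1 ∈ T

/-- The injective words over `T` of length `ℓ` in which `s` occurs, if at all, among the first
`i` letters. -/
def wordsBefore (s : S) (T : Finset S) (ℓ i : ℕ) : Set (List (S × L)) :=
  {w | IsInjectiveOver T w ∧ w.length = ℓ ∧ ∀ b ∈ w.drop i, b.1 ≠ s}

theorem wordsBefore_mono (s : S) {T U : Finset S} (h : T ⊆ U) (ℓ : ℕ) {i j : ℕ} (hij : i ≤ j) :
    (wordsBefore s T ℓ i : Set (List (S × L))) ⊆ wordsBefore s U ℓ j := by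
  rintro w ⟨h1, h2, h3⟩
  refine ⟨⟨h1.1, fun a ha => h (h1.2 a ha)⟩, h2, fun b hb => h3 b ?_⟩
  exact (List.drop_sublist_drop_left w hij).mem hb

variable {k}

theorem consMap_mem {P Q : Set (List (S × L))} {a : S × L} (h : ∀ w ∈ P, a :: w ∈ Q)
    {z : List (S × L) →₀ k} (hz : z ∈ Finsupp.supported k k P) :
    consMap k a z ∈ Finsupp.supported k k Q := by
  have : Finsupp.supported k k P ≤ (Finsupp.supported k k Q).comap (consMap k a) := by
    rw [Finsupp.supported_eq_span_single, Submodule.span_le]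
    rintro _ ⟨w, hw, rfl⟩
    simpa using Finsupp.single_mem_supported k 1 (h w hw)
  exact this hz

theorem map_mem_of_single {P : Set (List (S × L))} {N : Submodule k (List (S × L) →₀ k)}
    {f : (List (S × L) →₀ k) →ₗ[k] (List (S × L) →₀ k)}
    (h : ∀ w ∈ P, f (Finsupp.single w 1) ∈ N)
    {z : List (S × L) →₀ k} (hz : z ∈ Finsupp.supported k k P) : f z ∈ N := by
  have : Finsupp.supported k k P ≤ N.comap f := by
    rw [Finsupp.supported_eq_span_single, Submodule.span_le]
    rintro _ ⟨w, hw, rfl⟩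
    exact h w hw
  exact this hz

variable [DecidableEq S]

theorem isInjectiveOver_cons {T : Finset S} {a : S × L} {w : List (S × L)} :
    IsInjectiveOver T (a :: w) ↔ a.1 ∈ T ∧ IsInjectiveOver (T.erase a.1) w := by
  simp only [IsInjectiveOver, List.map_cons, List.nodup_cons, List.mem_cons, forall_eq_or_imp,
    Finset.mem_erase, List.mem_map, not_exists, not_and]
  constructor
  · rintro ⟨⟨h1, h2⟩, h3, h4⟩
    exact ⟨h3, h2, fun b hb => ⟨h1 b hb, h4 b hb⟩⟩
  · rintro ⟨h3, h2, h4⟩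
    exact ⟨⟨fun b hb => (h4 b hb).1, h2⟩, h3, fun b hb => (h4 b hb).2⟩

/-- A contraction of the complex of all words that preserves injective words over `T` of length
less than the cardinality of `T`. -/
structure IsContraction (T : Finset S)
    (H : (List (S × L) →₀ k) →ₗ[k] (List (S × L) →₀ k)) : Prop where
  homotopy : ∀ z, boundary k (H z) + H (boundary k z) = z
  mem : ∀ w : List (S × L), IsInjectiveOver T w → w.length < T.card →
    H (Finsupp.single w 1) ∈
      Finsupp.supported k k {v | IsInjectiveOver T v ∧ v.length = w.length + 1}

variable (H : Finset S → (List (S × L) →₀ k) →ₗ[k] (List (S × L) →₀ k)) (s : S)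

/-- Apply the contraction `H` to the part of a word after the letter `s`. -/
noncomputable def tailContractionWord : Finset S → List (S × L) → (List (S × L) →₀ k)
  | _, [] => 0
  | U, a :: w => if a.1 = s then -consMap k a (H (U.erase a.1) (Finsupp.single w 1))
      else -consMap k a (tailContractionWord (U.erase a.1) w)

/-- The linear extension of `tailContractionWord`. -/
noncomputable def tailContraction (U : Finset S) :
    (List (S × L) →₀ k) →ₗ[k] (List (S × L) →₀ k) :=
  Finsupp.linearCombination k (tailContractionWord H s U)

@[simp]
theorem tailContraction_single (U : Finset S) (w : List (S × L)) (r : k) :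
    tailContraction H s U (Finsupp.single w r) = r • tailContractionWord H s U w := by
  simp [tailContraction]

theorem tailContraction_consMap_self (U : Finset S) {a : S × L} (ha : a.1 = s)
    (z : List (S × L) →₀ k) :
    tailContraction H s U (consMap k a z) = -consMap k a (H (U.erase a.1) z) := by
  induction z using Finsupp.induction_linear with
  | zero => simp
  | add x y hx hy => simp only [map_add, hx, hy]; abel
  | single w r =>
    rw [← mul_one r, ← smul_eq_mul, ← Finsupp.smul_single]
    simp [tailContractionWord, ha, -Finsupp.smul_single]

theorem tailContraction_consMap_of_ne (U : Finset S) {a : S × L} (ha : a.1 ≠ s)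
    (z : List (S × L) →₀ k) :
    tailContraction H s U (consMap k a z) =
      -consMap k a (tailContraction H s (U.erase a.1) z) := by
  induction z using Finsupp.induction_linear with
  | zero => simp
  | add x y hx hy => simp only [map_add, hx, hy]; abel
  | single w r => simp [tailContractionWord, ha]

theorem tailContractionWord_eq_zero (U : Finset S) (w : List (S × L)) (hw : ∀ b ∈ w, b.1 ≠ s) :
    tailContractionWord H s U w = 0 := by
  induction w generalizing U with
  | nil => rfl
  | cons a w ih =>
    rw [tailContractionWord, if_neg (hw a (by simp)), ih _ fun b hb => hw b (by simp [hb])]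
    simp

/-- The contraction acts only after `s`, over the alphabet from which `s` and the letters before it
have been erased. Hence injectivity and the position of `s` are both preserved. -/
theorem tailContractionWord_mem (U : Finset S)
    (hH : ∀ V ⊆ U, s ∉ V → IsContraction V (H V)) (w : List (S × L)) (i : ℕ)
    (hw : w ∈ wordsBefore s U w.length i) (hlen : w.length < U.card) :
    tailContractionWord H s U w ∈ Finsupp.supported k k (wordsBefore s U (w.length + 1) i) := by
  induction w generalizing U i with
  | nil => exact Submodule.zero_mem _
  | cons a w ih =>
    rcases hw with ⟨h1, h2, h3⟩
    rw [isInjectiveOver_cons] at h1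
    have hcard : w.length < (U.erase a.1).card := by
      rw [Finset.card_erase_of_mem h1.1]; simp at hlen; omega
    rw [tailContractionWord]
    split_ifs with has
    · rcases i with _ | i
      · exact absurd has (h3 a (by simp))
      · refine Submodule.neg_mem _ (consMap_mem ?_
          ((hH _ (Finset.erase_subset _ _) (by simp [has])).mem w h1.2 hcard))
        rintro v ⟨hv, hv'⟩
        refine ⟨isInjectiveOver_cons.2 ⟨h1.1, hv⟩, by simp [hv'], fun b hb => ?_⟩
        rw [← has]
        exact Finset.ne_of_mem_erase (hv.2 b (List.mem_of_mem_drop hb))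
    · have hw' : w ∈ wordsBefore s (U.erase a.1) w.length (i - 1) := by
        refine ⟨h1.2, rfl, fun b hb => h3 b ?_⟩
        rcases i with _ | i
        · simp at hb ⊢; exact Or.inr hb
        · simpa using hb
      refine Submodule.neg_mem _ (consMap_mem ?_ (ih (U.erase a.1)
        (fun V hV hs => hH V (hV.trans (Finset.erase_subset _ _)) hs) (i - 1) hw' hcard))
      rintro v ⟨hv1, hv2, hv3⟩
      refine ⟨isInjectiveOver_cons.2 ⟨h1.1, hv1⟩, by simp [hv2], fun b hb => ?_⟩
      rcases i with _ | i
      · simp only [List.drop_zero, List.mem_cons] at hb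
        rcases hb with rfl | hb
        · exact has
        · exact hv3 b (by simpa using hb)
      · exact hv3 b (by simpa using hb)

/-- The self-map of the complex of words obtained from the identity by the homotopy
`tailContraction`. -/
noncomputable def pushMap (U : Finset S) : (List (S × L) →₀ k) →ₗ[k] (List (S × L) →₀ k) :=
  LinearMap.id - boundary k ∘ₗ tailContraction H s U - tailContraction H s U ∘ₗ boundary k

theorem pushMap_apply (U : Finset S) (z : List (S × L) →₀ k) :
    pushMap H s U z =
      z - boundary k (tailContraction H s U z) - tailContraction H s U (boundary k z) := rfl

theorem boundary_pushMap (U : Finset S) (z : List (S × L) →₀ k) :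
    boundary k (pushMap H s U z) = pushMap H s U (boundary k z) := by
  simp [pushMap_apply, boundary_boundary]

/-- `pushMap` is chain homotopic to the identity and moves `s` one place towards the front; an `s`
already in front disappears. With `i = 0`, truncated subtraction says that words without `s` stay
without `s`. -/
theorem pushMap_mem (U : Finset S)
    (hH : ∀ V ⊆ U, s ∉ V → IsContraction V (H V)) (w : List (S × L)) (i : ℕ)
    (hw : w ∈ wordsBefore s U w.length i) (hlen : w.length < U.card) :
    pushMap H s U (Finsupp.single w 1) ∈
      Finsupp.supported k k (wordsBefore s U w.length (i - 1)) := by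
  induction w generalizing U i with
  | nil =>
    simp only [pushMap_apply, tailContraction_single, tailContractionWord, boundary_single,
      boundaryWord, smul_zero, map_zero, sub_zero]
    exact Finsupp.single_mem_supported k 1 ⟨hw.1, rfl, by simp⟩
  | cons a w ih =>
    rcases hw with ⟨h1, h2, h3⟩
    rw [isInjectiveOver_cons] at h1
    have hcard : w.length < (U.erase a.1).card := by
      rw [Finset.card_erase_of_mem h1.1]; simp at hlen; omega
    have hw' : w ∈ wordsBefore s (U.erase a.1) w.length (i - 1) := by
      refine ⟨h1.2, rfl, fun b hb => h3 b ?_⟩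
      rcases i with _ | i
      · simp at hb ⊢; exact Or.inr hb
      · simpa using hb
    rw [← consMap_single]
    by_cases has : a.1 = s
    · have hc := hH (U.erase a.1) (Finset.erase_subset _ _) (by simp [has])
      have hzero : tailContractionWord H s U w = 0 :=
        tailContractionWord_eq_zero H s U w fun b hb => by
          rw [← has]; exact Finset.ne_of_mem_erase (h1.2.2 b hb)
      -- With `s` in front, the homotopy identity for the contraction of the tail cancels every term
      -- that still contains `s`.
      have heq : pushMap H s U (consMap k a (Finsupp.single w 1)) =
          H (U.erase a.1) (Finsupp.single w 1) := by
        rw [pushMap_apply, tailContraction_consMap_self H s U has, boundary_consMap, map_neg,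
          boundary_consMap, map_sub, tailContraction_consMap_self H s U has,
          tailContraction_single, hzero]
        have := congrArg (consMap k a) (hc.homotopy (Finsupp.single w 1))
        rw [map_add] at this
        rw [← this]
        simp
      rw [heq]
      refine Finsupp.supported_mono ?_ (hc.mem w h1.2 hcard)
      rintro v ⟨hv, hv'⟩
      refine ⟨⟨hv.1, fun b hb => Finset.mem_of_mem_erase (hv.2 b hb)⟩, by simp [hv'],
        fun b hb => ?_⟩
      rw [← has]
      exact Finset.ne_of_mem_erase (hv.2 b (List.mem_of_mem_drop hb))
    -- The two correction terms come from deleting `a`: the alphabet used is then `U` instead of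
    -- `U.erase a.1`. In both, `s` sits where it does in `w`, one place earlier than in `a :: w`.
    · have heq : pushMap H s U (consMap k a (Finsupp.single w 1)) =
          consMap k a (pushMap H s (U.erase a.1) (Finsupp.single w 1)) +
            tailContractionWord H s (U.erase a.1) w - tailContractionWord H s U w := by
        rw [pushMap_apply, tailContraction_consMap_of_ne H s U has, boundary_consMap, map_neg,
          boundary_consMap, map_sub, tailContraction_consMap_of_ne H s U has, pushMap_apply]
        simp only [tailContraction_single, one_smul, map_sub]
        abel
      rw [heq]
      have hHe : ∀ V ⊆ U.erase a.1, s ∉ V → IsContraction V (H V) :=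
        fun V hV hs => hH V (hV.trans (Finset.erase_subset _ _)) hs
      refine Submodule.sub_mem _ (Submodule.add_mem _ ?_ ?_) ?_
      · refine consMap_mem ?_ (ih (U.erase a.1) hHe (i - 1) hw' hcard)
        rintro v ⟨hv1, hv2, hv3⟩
        refine ⟨isInjectiveOver_cons.2 ⟨h1.1, hv1⟩, by simp [hv2], fun b hb => ?_⟩
        rcases i with _ | _ | i
        · simp only [zero_tsub, List.drop_zero, List.mem_cons] at hb
          rcases hb with rfl | hb
          · exact has
          · exact hv3 b (by simpa using hb)
        · simp only [zero_add, tsub_self, List.drop_zero, List.mem_cons] at hb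
          rcases hb with rfl | hb
          · exact has
          · exact hv3 b (by simpa using hb)
        · exact hv3 b (by simpa using hb)
      · exact Finsupp.supported_mono (wordsBefore_mono s (Finset.erase_subset _ _) _ le_rfl)
          (tailContractionWord_mem H s (U.erase a.1) hHe w _ hw' hcard)
      · refine tailContractionWord_mem H s U hH w _ ?_ (by simp at hlen; omega)
        exact wordsBefore_mono s (Finset.erase_subset _ _) _ le_rfl hw'

theorem pushMap_pow_mem (U : Finset S)
    (hH : ∀ V ⊆ U, s ∉ V → IsContraction V (H V)) (w : List (S × L))
    (hw : IsInjectiveOver U w) (hlen : w.length < U.card) (j : ℕ) :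
    (pushMap H s U ^ j) (Finsupp.single w 1) ∈
      Finsupp.supported k k (wordsBefore s U w.length (w.length - j)) := by
  induction j with
  | zero => exact Finsupp.single_mem_supported k 1 ⟨hw, rfl, by simp⟩
  | succ j ih =>
    rw [pow_succ', Module.End.mul_apply]
    refine map_mem_of_single ?_ ih
    intro v hv
    have hv' := hv.2.1
    have := pushMap_mem H s U hH v (w.length - j) (by rwa [hv']) (by omega)
    rwa [hv', Nat.sub_sub] at this

theorem exists_isContraction [Nonempty S] [Nonempty L] (T : Finset S) :
    ∃ H : (List (S × L) →₀ k) →ₗ[k] (List (S × L) →₀ k), IsContraction T H := by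
  induction T using Finset.strongInduction with
  | H T ih =>
    rcases T.eq_empty_or_nonempty with rfl | ⟨s, hs⟩
    · refine ⟨consMap k (Classical.arbitrary _), fun z => ?_, fun w _ h => ?_⟩
      · rw [boundary_consMap]; abel
      · simp at h
    -- Guarding the property by `V ⊆ T` and `s ∉ V` makes the choice total in `V`; the value `0`
    -- elsewhere is irrelevant.
    · have ih' : ∀ V : Finset S, ∃ H : (List (S × L) →₀ k) →ₗ[k] (List (S × L) →₀ k),
          V ⊆ T → s ∉ V → IsContraction V H := by
        intro V
        by_cases hV : V ⊂ T
        · obtain ⟨H, hH⟩ := ih V hV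
          exact ⟨H, fun _ _ => hH⟩
        · refine ⟨0, fun h1 h2 => absurd (Finset.ssubset_iff_subset_ne.2 ⟨h1, ?_⟩) hV⟩
          rintro rfl
          exact h2 hs
      choose H hH using ih'
      let a : S × L := (s, Classical.arbitrary L)
      let e := tailContraction H s T
      let φ := pushMap H s T
      have hcomm : ∀ (j : ℕ) (z : List (S × L) →₀ k),
          boundary k ((φ ^ j) z) = (φ ^ j) (boundary k z) := by
        intro j z
        induction j with
        | zero => rfl
        | succ j ihj =>
          rw [pow_succ', Module.End.mul_apply, Module.End.mul_apply, boundary_pushMap, ihj]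
      have hstep : ∀ z, boundary k (e z) + e (boundary k z) = z - φ z := by
        intro z
        change _ = z - pushMap H s T z
        rw [pushMap_apply]
        abel
      -- The sum telescopes to a homotopy from the identity to `φ ^ T.card`. On injective words
      -- shorter than `T.card` that power removes every `s`, so coning with `a` stays injective.
      refine ⟨∑ j ∈ Finset.range T.card, e ∘ₗ (φ ^ j) + consMap k a ∘ₗ (φ ^ T.card), ?_, ?_⟩
      · intro z
        have htel : ∀ m : ℕ, ∑ j ∈ Finset.range m,
            (boundary k (e ((φ ^ j) z)) + e ((φ ^ j) (boundary k z))) = z - (φ ^ m) z := by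
          intro m
          induction m with
          | zero => simp
          | succ m ihm =>
            rw [Finset.sum_range_succ, ihm, ← hcomm, hstep, pow_succ', Module.End.mul_apply]
            abel
        have := htel T.card
        simp only [LinearMap.add_apply, LinearMap.sum_apply, LinearMap.comp_apply, map_add,
          map_sum, boundary_consMap, hcomm]
        rw [Finset.sum_add_distrib] at this
        rw [eq_comm, ← sub_eq_iff_eq_add.2 this.symm]
        abel
      · intro w hw hlen
        have hsub : ∀ ℓ i, (wordsBefore s T ℓ i : Set (List (S × L))) ⊆
            {v | IsInjectiveOver T v ∧ v.length = ℓ} := fun ℓ i v hv => ⟨hv.1, hv.2.1⟩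
        simp only [LinearMap.add_apply, LinearMap.sum_apply, LinearMap.comp_apply]
        refine Submodule.add_mem _ (Submodule.sum_mem _ fun j _ => ?_) ?_
        · refine map_mem_of_single ?_ (pushMap_pow_mem H s T hH w hw hlen j)
          intro v hv
          have hv' := hv.2.1
          have := tailContractionWord_mem H s T hH v (w.length - j) (by rwa [hv']) (by omega)
          rw [hv'] at this
          simpa [e] using Finsupp.supported_mono (hsub _ _) this
        · refine consMap_mem ?_ (pushMap_pow_mem H s T hH w hw hlen T.card)
          rintro v ⟨hv1, hv2, hv3⟩
          refine ⟨isInjectiveOver_cons.2 ⟨hs, hv1.1, fun b hb => ?_⟩, by simp [hv2]⟩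
          refine Finset.mem_erase.2 ⟨hv3 b ?_, hv1.2 b hb⟩
          rwa [Nat.sub_eq_zero_of_le hlen.le, List.drop_zero]

/-- The complex of injective words over a set with `n` letters is exact in lengths below `n`. -/
theorem exists_boundary_eq [Nonempty S] [Nonempty L] (T : Finset S) {ℓ : ℕ} (hℓ : ℓ < T.card)
    {z : List (S × L) →₀ k}
    (hz : z ∈ Finsupp.supported k k {w | IsInjectiveOver T w ∧ w.length = ℓ})
    (hd : boundary k z = 0) :
    ∃ y ∈ Finsupp.supported k k {w | IsInjectiveOver T w ∧ w.length = ℓ + 1},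
      boundary k y = z := by
  obtain ⟨H, hH⟩ := exists_isContraction (k := k) (L := L) T
  refine ⟨H z, map_mem_of_single ?_ hz, ?_⟩
  · rintro w ⟨hw, rfl⟩
    exact hH.mem w hw hℓ
  · simpa [hd] using hH.homotopy z

end Contraction

end InjectiveWords

/-! ### Acyclicity of relatively free representations, and free covers. -/

namespace groupHomology

open Rep Finsupp Limits

section RelativelyFree

variable {k G H : Type u} [CommRing k] [Group G] [Group H]

/-- A representation `A` of `G` is relatively free if it is a direct sum of the translates of a
`k`-submodule. Such a decomposition is encoded by the map that sends an element of the translate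
of the submodule by `g` to its product by `g⁻¹`, labelled by `g⁻¹`. -/
def IsRelativelyFree (A : Rep.{u} k G) : Prop :=
  ∃ s : A →ₗ[k] (G →₀ A),
    (∀ a, (Finsupp.lsum k fun g => A.ρ g⁻¹) (s a) = a) ∧
    ∀ (h : G) (a : A), s (A.ρ h⁻¹ a) = Finsupp.lmapDomain A k (· * h) (s a)

/-- Insert a new first entry in a chain, as prescribed by `s`. -/
noncomputable def insertFirst {A : Rep.{u} k G} (s : A →ₗ[k] (G →₀ A)) (n : ℕ) :
    ((Fin n → G) →₀ A) →ₗ[k] ((Fin (n + 1) → G) →₀ A) :=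
  Finsupp.lsum k fun g => Finsupp.lmapDomain A k (fun g₀ => Fin.cons g₀ g) ∘ₗ s

/-- The face dropping the new entry returns `z` by `h₁`; the face multiplying it into the old first
entry matches the action term of `d` by `h₂`; the other faces commute with the insertion up to sign.
-/
theorem d_insertFirst {A : Rep.{u} k G} {s : A →ₗ[k] (G →₀ A)}
    (h₁ : ∀ a, (Finsupp.lsum k fun g => A.ρ g⁻¹) (s a) = a)
    (h₂ : ∀ (h : G) (a : A), s (A.ρ h⁻¹ a) = Finsupp.lmapDomain A k (· * h) (s a))
    (n : ℕ) (z : (Fin (n + 1) → G) →₀ A) :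
    inhomogeneousChains.d A (n + 1) (insertFirst s (n + 1) z) =
      z - insertFirst s n (inhomogeneousChains.d A n z) := by
  induction z using Finsupp.induction_linear with
  | zero => simp
  | add x y hx hy => simp only [map_add, hx, hy]; abel
  | single g a =>
    have key : ∀ w : G →₀ A, inhomogeneousChains.d A (n + 1)
        (Finsupp.lmapDomain A k (fun g₀ => (Fin.cons g₀ g : Fin (n + 2) → G)) w) =
        single g ((Finsupp.lsum k fun g => A.ρ g⁻¹) w) -
        (Finsupp.lmapDomain A k (fun g₀ => (Fin.cons g₀ (fun i : Fin n => g i.succ) :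
          Fin (n + 1) → G)) (Finsupp.lmapDomain A k (· * g 0) w) +
          ∑ j : Fin (n + 1), (-1 : k) ^ ((j : ℕ) + 1) •
            Finsupp.lmapDomain A k (fun g₀ => (Fin.cons g₀ (Fin.contractNth j (· * ·) g) :
              Fin (n + 1) → G)) w) := by
      intro w
      induction w using Finsupp.induction_linear with
      | zero => simp
      | add x y hx hy =>
        simp only [map_add, hx, hy, single_add, smul_add, Finset.sum_add_distrib]
        abel
      | single g₀ b =>
        rw [Finsupp.lmapDomain_apply, Finsupp.mapDomain_single, inhomogeneousChains.d_single,
          Fin.sum_univ_succ]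
        have h0 : Fin.contractNth (0 : Fin (n + 2)) (· * ·) (Fin.cons g₀ g : Fin (n + 2) → G) =
            (Fin.cons (g₀ * g 0) (fun i : Fin n => g i.succ) : Fin (n + 1) → G) := by
          ext i
          refine Fin.cases ?_ (fun i => ?_) i
          · simp [Fin.contractNth]
          · simp [Fin.contractNth]
        have hs : ∀ j : Fin (n + 1),
            Fin.contractNth j.succ (· * ·) (Fin.cons g₀ g : Fin (n + 2) → G) =
            (Fin.cons g₀ (Fin.contractNth j (· * ·) g) : Fin (n + 1) → G) := by
          intro j
          ext i
          refine Fin.cases ?_ (fun i => ?_) i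
          · simp [Fin.contractNth]
          · simp [Fin.contractNth]
        simp [h0, hs, pow_succ]
        abel
    rw [inhomogeneousChains.d_single]
    simp only [insertFirst, Finsupp.lsum_single, map_add, map_sum, map_smul, LinearMap.comp_apply]
    rw [key, h₁, h₂]

theorem IsRelativelyFree.isZero {A : Rep.{u} k G} (hA : IsRelativelyFree A) (n : ℕ) :
    IsZero (groupHomology A (n + 1)) := by
  obtain ⟨s, h₁, h₂⟩ := hA
  change IsZero ((inhomogeneousChains A).homology (n + 1))
  rw [← HomologicalComplex.exactAt_iff_isZero_homology,
    HomologicalComplex.exactAt_iff' _ (n + 2) (n + 1) n (by simp) (by simp),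
    ShortComplex.moduleCat_exact_iff]
  have key : ∀ z : (Fin (n + 1) → G) →₀ A, inhomogeneousChains.d A n z = 0 →
      inhomogeneousChains.d A (n + 1) (insertFirst s (n + 1) z) = z := by
    intro z hz
    rw [d_insertFirst h₁ h₂, hz, map_zero, sub_zero]
  rw [← inhomogeneousChains.d_def, ← inhomogeneousChains.d_def] at key
  exact fun z hz => ⟨insertFirst s (n + 1) z, key z hz⟩

theorem IsRelativelyFree.res {A : Rep.{u} k G} (hA : IsRelativelyFree A) (f : H →* G)
    (hf : Function.Injective f) : IsRelativelyFree (Rep.res f A) := by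
  obtain ⟨s, h₁, h₂⟩ := hA
  -- Coset representatives `q` write `g = q g * f (r g)`. The summand labelled `g` is relabelled `r
  -- g` and translated by `f (r g) * g⁻¹ = (q g)⁻¹`.
  obtain ⟨r, hr⟩ : ∃ r : G → H, ∀ g h, r (g * f h) = r g * h := by
    let q : G → G := fun g => (QuotientGroup.mk (s := f.range) g).out
    have hq : ∀ g, ∃ h, q g * f h = g := fun g => by
      obtain ⟨⟨_, h, rfl⟩, hh⟩ := QuotientGroup.mk_out_eq_mul f.range g
      exact ⟨h⁻¹, by simp [q, hh]⟩
    choose r hr using hq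
    refine ⟨r, fun g h => hf ?_⟩
    have e : q (g * f h) = q g := by
      simp only [q]
      congr 1
      rw [QuotientGroup.eq]
      exact ⟨h⁻¹, by simp⟩
    have h1 := hr (g * f h)
    rw [e] at h1
    rw [map_mul]
    refine mul_left_cancel (a := q g) ?_
    rw [h1, ← mul_assoc, hr]
  let t : (G →₀ A) →ₗ[k] (H →₀ A) :=
    Finsupp.lsum k fun g => Finsupp.lsingle (r g) ∘ₗ A.ρ (f (r g) * g⁻¹)
  refine ⟨t ∘ₗ s, fun a => ?_, fun h a => ?_⟩
  · have : (Finsupp.lsum k fun h => A.ρ (f h)⁻¹) ∘ₗ t = Finsupp.lsum k fun g => A.ρ g⁻¹ := by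
      ext g b
      simp [t, ← Module.End.mul_apply, ← map_mul]
    have h3 := LinearMap.congr_fun this (s a)
    rw [h₁] at h3
    simpa using! h3
  · have : t ∘ₗ Finsupp.lmapDomain A k (· * f h) = Finsupp.lmapDomain A k (· * h) ∘ₗ t := by
      ext g b : 2
      simp [t, hr]
    have h3 := LinearMap.congr_fun this (s a)
    have h4 := h₂ (f h) a
    simp only [LinearMap.comp_apply] at h3 ⊢
    erw [← h3, ← h4]
    simp

end RelativelyFree

section FinsuppRep

variable {k G : Type u} [CommRing k] [Group G]

/-- For a `G`-set `X` and a representation `B`, the representation `k[X] ⊗ B` with the diagonal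
action, as finitely supported functions on `X`. -/
noncomputable abbrev finsuppRep (X : Type u) [MulAction G X] (B : Rep.{u} k G) : Rep.{u} k G :=
  Rep.of (X := X →₀ B)
    { toFun := fun g => Finsupp.lsum k fun x => Finsupp.lsingle (g • x) ∘ₗ B.ρ g
      map_one' := by ext; simp
      map_mul' := fun g h => by ext; simp [mul_smul] }

theorem finsuppRep_ρ_single (X : Type u) [MulAction G X] (B : Rep.{u} k G) (g : G) (x : X)
    (b : B) : (finsuppRep X B).ρ g (single x b) = single (g • x) (B.ρ g b) := by
  simp

theorem IsRelativelyFree.finsuppRep (X : Type u) [MulAction G X] {B : Rep.{u} k G}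
    (hB : IsRelativelyFree B) : IsRelativelyFree (finsuppRep X B) := by
  obtain ⟨s, h₁, h₂⟩ := hB
  let t : X → (G →₀ B) →ₗ[k] (G →₀ X →₀ B) := fun x =>
    Finsupp.lsum k fun g => Finsupp.lsingle g ∘ₗ Finsupp.lsingle (g • x)
  refine ⟨Finsupp.lsum k fun x => t x ∘ₗ s, fun a => ?_, fun h a => ?_⟩
  · induction a using Finsupp.induction_linear with
    | zero => simp
    | add x y hx hy => simp only [map_add, hx, hy]
    | single x b =>
      have : (Finsupp.lsum k fun g => (groupHomology.finsuppRep X B).ρ g⁻¹) ∘ₗ t x =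
          Finsupp.lsingle x ∘ₗ Finsupp.lsum k fun g => B.ρ g⁻¹ := by
        ext g b : 2
        simp only [t, LinearMap.comp_apply, lsingle_apply, lsum_single]
        rw [finsuppRep_ρ_single, inv_smul_smul]
      have h3 := LinearMap.congr_fun this (s b)
      simp only [LinearMap.comp_apply, h₁] at h3
      simpa using! h3
  · induction a using Finsupp.induction_linear with
    | zero => simp
    | add x y hx hy => simp only [map_add, hx, hy]
    | single x b =>
      have : t (h⁻¹ • x) ∘ₗ Finsupp.lmapDomain B k (· * h) =
          Finsupp.lmapDomain (X →₀ B) k (· * h) ∘ₗ t x := by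
        ext g b : 2
        simp [t, mul_smul]
      have h3 := LinearMap.congr_fun this (s b)
      rw [finsuppRep_ρ_single]
      simp only [LinearMap.comp_apply, ← h₂] at h3
      simpa using! h3

/-- The relatively free representation `k[G] ⊗ V` covering a representation `V`. -/
noncomputable abbrev freeCover (B : Rep.{u} k G) : Rep.{u} k G :=
  finsuppRep G (Rep.trivial k G B)

theorem isRelativelyFree_freeCover (B : Rep.{u} k G) : IsRelativelyFree (freeCover B) := by
  refine ⟨Finsupp.lsum k fun g => Finsupp.lsingle g⁻¹ ∘ₗ Finsupp.lsingle 1,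
    fun a => ?_, fun h a => ?_⟩
  · induction a using Finsupp.induction_linear with
    | zero => simp
    | add x y hx hy => simp only [map_add, hx, hy]
    | single x b => simp
  · induction a using Finsupp.induction_linear with
    | zero => simp
    | add x y hx hy => simp only [map_add, hx, hy]
    | single x b => simp

/-- The projection of the free cover. -/
noncomputable def freeCoverHom (B : Rep.{u} k G) : freeCover B ⟶ B :=
  Rep.ofHom ⟨Finsupp.lsum k fun g => B.ρ g, fun g => by ext; simp⟩

theorem freeCoverHom_single (B : Rep.{u} k G) (g : G) (b : B) :
    (freeCoverHom B).hom (single g b) = B.ρ g b := by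
  change (Finsupp.lsum k fun g => B.ρ g) (single g b) = _
  simp

instance (B : Rep.{u} k G) : Epi (freeCoverHom B) := by
  rw [Rep.epi_iff_surjective]
  intro b
  exact ⟨single 1 b, (freeCoverHom_single B 1 b).trans (by simp)⟩

/-- The short exact sequence `0 ⟶ K ⟶ k[G] ⊗ B ⟶ B ⟶ 0`. -/
noncomputable abbrev coverSequence (B : Rep.{u} k G) : ShortComplex (Rep.{u} k G) :=
  ShortComplex.mk (kernel.ι (freeCoverHom B)) (freeCoverHom B) (kernel.condition _)

theorem coverSequence_shortExact (B : Rep.{u} k G) : (coverSequence B).ShortExact where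
  exact := ShortComplex.exact_kernel _

end FinsuppRep

end groupHomology

/-! ### Inner automorphisms and Shapiro's lemma by dimension shifting. -/

namespace groupHomology

open Rep Finsupp Limits

variable {k G H : Type u} [CommRing k] [Group G] [Group H]

theorem chainsMap_comm {A A' : Rep.{u} k G} {B B' : Rep.{u} k H} (f : G →* H)
    (φ : A ⟶ Rep.res f B) (φ' : A' ⟶ Rep.res f B') (a : A ⟶ A') (b : B ⟶ B')
    (h : ∀ x, φ'.hom (a.hom x) = b.hom (φ.hom x)) :
    chainsMap f φ ≫ chainsMap (MonoidHom.id H) b =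
      chainsMap (MonoidHom.id G) a ≫ chainsMap f φ' := by
  rw [← chainsMap_comp, ← chainsMap_comp]
  refine chainsMap_congr rfl ?_
  ext x
  exact (h x).symm

/-- The morphism between short complexes of chains induced by a group homomorphism and a
compatible morphism between short complexes of representations. -/
noncomputable abbrev shortComplexChainsMap {X : ShortComplex (Rep.{u} k G)}
    {Y : ShortComplex (Rep.{u} k H)} (f : G →* H)
    (φ₁ : X.X₁ ⟶ Rep.res f Y.X₁) (φ₂ : X.X₂ ⟶ Rep.res f Y.X₂) (φ₃ : X.X₃ ⟶ Rep.res f Y.X₃)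
    (h₁₂ : ∀ x, φ₂.hom (X.f.hom x) = Y.f.hom (φ₁.hom x))
    (h₂₃ : ∀ x, φ₃.hom (X.g.hom x) = Y.g.hom (φ₂.hom x)) :
    X.map (chainsFunctor k G) ⟶ Y.map (chainsFunctor k H) where
  τ₁ := chainsMap f φ₁
  τ₂ := chainsMap f φ₂
  τ₃ := chainsMap f φ₃
  comm₁₂ := chainsMap_comm f φ₁ φ₂ X.f Y.f h₁₂
  comm₂₃ := chainsMap_comm f φ₂ φ₃ X.g Y.g h₂₃

section Conjugation

/-- The action of `g`, as a morphism compatible with conjugation by `g`. -/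
noncomputable abbrev conjHom (g : G) (B : Rep.{u} k G) :
    B ⟶ Rep.res (MulAut.conj g).toMonoidHom B :=
  Rep.ofHom ⟨B.ρ g, fun h => by ext; simp [← Module.End.mul_apply, ← map_mul]⟩

theorem H0π_ρ (B : Rep.{u} k G) (g : G) (b : B) : H0π B (B.ρ g b) = H0π B b := by
  apply (ConcreteCategory.bijective_of_isIso (H0Iso B).hom).1
  rw [← ConcreteCategory.comp_apply, ← ConcreteCategory.comp_apply, H0π_comp_H0Iso_hom]
  exact Representation.Coinvariants.mk_self_apply B.ρ g b

/-- Inner automorphisms act trivially on group homology. -/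
theorem map_conj (g : G) (B : Rep.{u} k G) (n : ℕ) :
    map (MulAut.conj g).toMonoidHom (conjHom g B) n = 𝟙 _ := by
  induction n generalizing B with
  | zero =>
    rw [← cancel_epi (H0π B), H0π_comp_map, Category.comp_id]
    ext b
    exact H0π_ρ B g b
  | succ n ih =>
    have hX := coverSequence_shortExact B
    -- The cover is acyclic, so the connecting map embeds degree `n + 1` of `B` into degree `n` of
    -- the kernel, where the claim is known.
    have := mono_δ_of_isZero hX n ((isRelativelyFree_freeCover B).isZero n)
    rw [← cancel_mono (δ hX (n + 1) n rfl)]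
    have nat := HomologicalComplex.HomologySequence.δ_naturality
      (shortComplexChainsMap (X := coverSequence B) (Y := coverSequence B)
        (MulAut.conj g).toMonoidHom (conjHom g _) (conjHom g _) (conjHom g _)
        (fun x => (Rep.hom_comm_apply _ g x).symm) (fun x => (Rep.hom_comm_apply _ g x).symm))
      (map_chainsFunctor_shortExact hX) (map_chainsFunctor_shortExact hX) (n + 1) n rfl
    have e := ih (coverSequence B).X₁
    refine nat.symm.trans ?_
    refine (congrArg (fun t => δ hX (n + 1) n rfl ≫ t) e).trans ?_
    simp

end Conjugation

section Shapiro

variable (X : Type u) [MulAction G X]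

/-- The functoriality of `finsuppRep`. -/
noncomputable abbrev finsuppRepMap {B B' : Rep.{u} k G} (f : B ⟶ B') :
    finsuppRep X B ⟶ finsuppRep X B' :=
  Rep.ofHom ⟨Finsupp.mapRange.linearMap f.hom.toLinearMap, fun g => by
    ext x b : 2
    simp [Rep.hom_comm_apply f]⟩

theorem shortExact_of_exact {S : ShortComplex (Rep.{u} k G)}
    (hf : Function.Injective S.f.hom) (hg : Function.Surjective S.g.hom)
    (h : ∀ x, S.g.hom x = 0 → ∃ y, S.f.hom y = x) : S.ShortExact where
  exact := by
    rw [← ShortComplex.exact_map_iff_of_faithful S (forget₂ (Rep.{u} k G) (ModuleCat k)),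
      ShortComplex.moduleCat_exact_iff]
    exact h
  mono_f := (Rep.mono_iff_injective _).2 hf
  epi_g := (Rep.epi_iff_surjective _).2 hg

theorem exists_of_shortExact {S : ShortComplex (Rep.{u} k G)} (hS : S.ShortExact)
    (x : S.X₂) (hx : S.g.hom x = 0) : ∃ y, S.f.hom y = x := by
  have := hS.exact
  rw [← ShortComplex.exact_map_iff_of_faithful S (forget₂ (Rep.{u} k G) (ModuleCat k)),
    ShortComplex.moduleCat_exact_iff] at this
  exact this x hx

/-- The image of a short complex under `finsuppRep X`. -/
noncomputable abbrev finsuppRepShortComplex (S : ShortComplex (Rep.{u} k G)) :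
    ShortComplex (Rep.{u} k G) :=
  ShortComplex.mk (finsuppRepMap X S.f) (finsuppRepMap X S.g) (by
    ext x b : 4
    have h : S.g.hom (S.f.hom b) = 0 := congr(($S.zero).hom b)
    simp [h])

theorem finsuppRepShortComplex_shortExact {S : ShortComplex (Rep.{u} k G)} (hS : S.ShortExact) :
    (finsuppRepShortComplex X S).ShortExact := by
  have hf := (Rep.mono_iff_injective _).1 hS.mono_f
  have hg := (Rep.epi_iff_surjective _).1 hS.epi_g
  refine shortExact_of_exact (Finsupp.mapRange_injective _ (map_zero _) hf)
    (Finsupp.mapRange_surjective _ (map_zero _) hg) ?_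
  have hker : LinearMap.ker S.g.hom.toLinearMap = LinearMap.range S.f.hom.toLinearMap := by
    ext x
    constructor
    · exact fun hx => exists_of_shortExact hS x hx
    · rintro ⟨y, rfl⟩
      exact congr(($S.zero).hom y)
  have := Finsupp.ker_mapRange (I := X) S.g.hom.toLinearMap
  rw [hker, ← Finsupp.range_mapRange_linearMap (I := X) S.f.hom.toLinearMap
    (LinearMap.ker_eq_bot.2 hf)] at this
  intro x hx
  have hx' : x ∈ LinearMap.ker (Finsupp.mapRange.linearMap (α := X) S.g.hom.toLinearMap) := hx
  rw [this] at hx'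
  exact hx'

variable {X} (ι : H →* G) (x₀ : X) (hι : ∀ h, ι h • x₀ = x₀)

/-- The inclusion of `B` as the summand at `x₀` in `k[X] ⊗ B`. -/
noncomputable abbrev singleHom (B : Rep.{u} k G) : Rep.res ι B ⟶ Rep.res ι (finsuppRep X B) :=
  Rep.ofHom ⟨Finsupp.lsingle x₀, fun h => by ext; simp [hι]⟩

theorem isIso_map_singleHom_zero
    (htrans : ∀ x : X, ∃ g : G, g • x₀ = x) (hstab : ∀ g : G, g • x₀ = x₀ → g ∈ ι.range)
    (B : Rep.{u} k G) : IsIso (map ι (singleHom ι x₀ hι B) 0) := by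
  choose t ht using htrans
  rw [ConcreteCategory.isIso_iff_bijective]
  have hπ : ∀ b : B, map ι (singleHom ι x₀ hι B) 0 (H0π (Rep.res ι B) b) =
      H0π (finsuppRep X B) (single x₀ b) := fun b =>
    congr($(H0π_comp_map ι (singleHom ι x₀ hι B)) b)
  constructor
  -- A left inverse on coinvariants carries the summand at `x` back to `x₀`. The factor `t x₀` is
  -- there because `t x₀` need not be `1`.
  · let q : (X →₀ B) →ₗ[k] H0 (Rep.res ι B) :=
      Finsupp.lsum k fun x => (H0π (Rep.res ι B)).hom ∘ₗ B.ρ ((t x₀) * (t x)⁻¹)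
    have hq : ∀ g : G, q ∘ₗ (finsuppRep X B).ρ g = q := by
      intro g
      ext x b
      simp only [LinearMap.comp_apply, Finsupp.lsingle_apply]
      rw [finsuppRep_ρ_single]
      simp only [q, Finsupp.lsum_single, LinearMap.comp_apply]
      obtain ⟨h, hh⟩ : t x₀ * (t (g • x))⁻¹ * g * (t x) * (t x₀)⁻¹ ∈ ι.range := by
        apply hstab
        have e1 : (t x₀)⁻¹ • x₀ = x₀ := inv_smul_eq_iff.2 (ht x₀).symm
        rw [mul_smul, mul_smul, mul_smul, mul_smul, e1, ht, inv_smul_eq_iff.2 (ht (g • x)).symm, ht]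
      have := H0π_ρ (Rep.res ι B) h (B.ρ (t x₀ * (t x)⁻¹) b)
      refine Eq.trans ?_ this
      congr 1
      change _ = B.ρ (ι h) _
      rw [hh, ← Module.End.mul_apply, ← Module.End.mul_apply, ← map_mul, ← map_mul]
      congr 2
      group
    let q' : H0 (finsuppRep X B) → H0 (Rep.res ι B) := fun y =>
      Representation.Coinvariants.lift _ q hq ((H0Iso (finsuppRep X B)).hom y)
    have hq' : ∀ z, q' (H0π _ z) = q z := by
      intro z
      change Representation.Coinvariants.lift _ q hq
        ((H0Iso (finsuppRep X B)).hom (H0π _ z)) = _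
      rw [← ConcreteCategory.comp_apply, H0π_comp_H0Iso_hom]
      rfl
    apply Function.LeftInverse.injective (g := q')
    intro y
    induction y using H0_induction_on with
    | h b =>
      rw [hπ, hq']
      simp [q]
  · intro y
    induction y using H0_induction_on with
    | h z =>
      induction z using Finsupp.induction_linear with
      | zero => exact ⟨0, by simp⟩
      | add x y hx hy =>
        obtain ⟨x', hx⟩ := hx
        obtain ⟨y', hy⟩ := hy
        exact ⟨x' + y', by rw [map_add, hx, hy, map_add]⟩
      | single x b =>
        refine ⟨H0π (Rep.res ι B) (B.ρ (t x)⁻¹ b), ?_⟩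
        rw [hπ, ← H0π_ρ _ (t x), finsuppRep_ρ_single, ht]
        simp

/-- Shapiro's lemma for a transitive `G`-set, in terms of the map induced by the inclusion of a
stabilizer. -/
theorem isIso_map_singleHom (hinj : Function.Injective ι)
    (htrans : ∀ x : X, ∃ g : G, g • x₀ = x) (hstab : ∀ g : G, g • x₀ = x₀ → g ∈ ι.range)
    (B : Rep.{u} k G) (n : ℕ) : IsIso (map ι (singleHom ι x₀ hι B) n) := by
  -- In positive degrees both sides vanish on free covers.
  have hfree : ∀ (B : Rep.{u} k G) (n : ℕ),
      IsIso (map ι (singleHom ι x₀ hι (freeCover B)) n) := by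
    intro B n
    rcases n with _ | n
    · exact isIso_map_singleHom_zero ι x₀ hι htrans hstab _
    · have hB := isRelativelyFree_freeCover B
      exact ((hB.res ι hinj).isZero n).isIso ((hB.finsuppRep X).isZero n) _
  -- The five lemma is applied in two rounds: one degree lower gives surjectivity for every
  -- representation, and surjectivity for the kernel then gives an isomorphism for `B`.
  have step : ∀ (B : Rep.{u} k G) (n : ℕ),
      (∀ j, (ComplexShape.down ℕ).Rel n j →
        IsIso (map ι (singleHom ι x₀ hι (kernel (freeCoverHom B))) j)) →
      Epi (map ι (singleHom ι x₀ hι B) n) ∧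
      (Epi (map ι (singleHom ι x₀ hι (kernel (freeCoverHom B))) n) →
        IsIso (map ι (singleHom ι x₀ hι B) n)) := by
    intro B n hK
    have hS := coverSequence_shortExact B
    let φ := shortComplexChainsMap (X := (coverSequence B).map (Rep.resFunctor ι))
        (Y := finsuppRepShortComplex X (coverSequence B)) ι
        (singleHom ι x₀ hι _) (singleHom ι x₀ hι _) (singleHom ι x₀ hι _)
        (fun _ => (Finsupp.mapRange_single (hf := map_zero _)).symm)
        (fun _ => (Finsupp.mapRange_single (hf := map_zero _)).symm)
    have h₁ := map_chainsFunctor_shortExact ((Rep.shortExact_res ι).2 hS)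
    have h₂ := map_chainsFunctor_shortExact (finsuppRepShortComplex_shortExact X hS)
    constructor
    · refine HomologicalComplex.HomologySequence.epi_homologyMap_τ₃ φ h₁ h₂ n ?_ ?_ ?_
      · have := hfree B n
        exact inferInstanceAs (Epi (map ι (singleHom ι x₀ hι (freeCover B)) n))
      · intro j hj
        have := hK j hj
        exact inferInstanceAs (Epi (map ι (singleHom ι x₀ hι (kernel (freeCoverHom B))) j))
      · intro j hj
        have := hfree B j
        exact inferInstanceAs (Mono (map ι (singleHom ι x₀ hι (freeCover B)) j))
    · intro hepi
      refine HomologicalComplex.HomologySequence.isIso_homologyMap_τ₃ φ h₁ h₂ n hepi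
        (hfree B n) hK ?_
      intro j hj
      have := hfree B j
      exact inferInstanceAs (Mono (map ι (singleHom ι x₀ hι (freeCover B)) j))
  have main : ∀ (n : ℕ) (B : Rep.{u} k G), IsIso (map ι (singleHom ι x₀ hι B) n) := by
    intro n
    induction n with
    | zero =>
      have hj : ∀ j, ¬ (ComplexShape.down ℕ).Rel 0 j := by simp
      exact fun B => (step B 0 fun j h => absurd h (hj j)).2
        (step _ 0 fun j h => absurd h (hj j)).1
    | succ n ih =>
      have hj : ∀ j, (ComplexShape.down ℕ).Rel (n + 1) j → j = n := by
        intro j h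
        simpa using h
      exact fun B => (step B (n + 1) fun j h => by rw [hj j h]; exact ih _).2
        (step _ (n + 1) fun j h => by rw [hj j h]; exact ih _).1
  exact main n B

end Shapiro

end groupHomology

/-! ### The wreath product acting on labelled letters and injective words. -/

namespace SymWreath

variable {G : Type u} [Group G] {m n ℓ : ℕ}

/-- The action of `G ≀ Σ_n` on the set `{0, …, n-1} × G` of labelled letters. -/
instance : MulAction (SymWreath G n) (Fin n × G) where
  smul x a := (x.right a.1, x.left (x.right a.1) * a.2)
  one_smul a := by
    change ((1 : SymWreath G n).right a.1, (1 : SymWreath G n).left _ * a.2) = a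
    simp
  mul_smul x y a := by
    change ((x * y).right a.1, (x * y).left ((x * y).right a.1) * a.2) =
      (x.right (y.right a.1), x.left (x.right (y.right a.1)) *
        (y.left (y.right a.1) * a.2))
    have : (mulAutArrow x.right y.left) (x.right (y.right a.1)) = y.left (y.right a.1) := by
      change y.left (x.right⁻¹ • (x.right (y.right a.1))) = _
      simp
    simp [this, mul_assoc]

theorem smul_def (x : SymWreath G n) (a : Fin n × G) :
    x • a = (x.right a.1, x.left (x.right a.1) * a.2) := rfl

/-- Identities in the wreath product are checked through this faithful action. -/
theorem ext_smul {x y : SymWreath G n} (h : ∀ i, x • ((i, 1) : Fin n × G) = y • (i, 1)) :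
    x = y := by
  have h1 : x.right = y.right := Equiv.ext fun i => congrArg Prod.fst (h i)
  refine SemidirectProduct.ext (funext fun i => ?_) h1
  have := congrArg Prod.snd (h (x.right⁻¹ i))
  simpa [smul_def, ← h1] using this

/-- The inclusion `G ≀ Σ_m → G ≀ Σ_n` for `m ≤ n`. -/
noncomputable def castLEHom (G : Type u) [Group G] (h : m ≤ n) : SymWreath G m →* SymWreath G n where
  toFun x := ⟨fun i => if hi : i.1 < m then x.left ⟨i, hi⟩ else 1,
    Equiv.Perm.viaEmbeddingHom (Fin.castLEEmb h) x.right⟩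
  map_one' := by
    refine SemidirectProduct.ext (funext fun i => ?_) ?_ <;> simp
  map_mul' x y := by
    refine SemidirectProduct.ext (funext fun i => ?_) ?_
    · change (if hi : i.1 < m then x.left ⟨i, hi⟩ * y.left (x.right⁻¹ ⟨i, hi⟩) else 1) =
        (if hi : i.1 < m then x.left ⟨i, hi⟩ else 1) *
        (fun i : Fin n => if hi : i.1 < m then y.left ⟨i, hi⟩ else 1)
          ((Equiv.Perm.viaEmbeddingHom (Fin.castLEEmb h) x.right)⁻¹ i)
      rw [← map_inv]
      by_cases hi : i.1 < m
      · have := Equiv.Perm.viaEmbedding_apply x.right⁻¹ (Fin.castLEEmb h) ⟨i, hi⟩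
        have e : (Fin.castLEEmb h) ⟨i, hi⟩ = i := rfl
        rw [e] at this
        rw [Equiv.Perm.viaEmbeddingHom_apply, this]
        simp [hi]
      · rw [Equiv.Perm.viaEmbeddingHom_apply, Equiv.Perm.viaEmbedding_apply_of_notMem]
        · simp [hi]
        · rintro ⟨j, rfl⟩
          exact hi j.2
    · simp

theorem castLEHom_smul_castLE (h : m ≤ n) (x : SymWreath G m) (i : Fin m) (g : G) :
    castLEHom G h x • ((i.castLE h, g) : Fin n × G) =
      ((x • ((i, g) : Fin m × G)).1.castLE h, (x • ((i, g) : Fin m × G)).2) := by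
  have := Equiv.Perm.viaEmbedding_apply x.right (Fin.castLEEmb h) i
  simp only [Fin.castLEEmb_apply] at this
  simp [smul_def, castLEHom, Equiv.Perm.viaEmbeddingHom_apply, this]

theorem castLEHom_smul_of_le (h : m ≤ n) (x : SymWreath G m) (a : Fin n × G) (ha : m ≤ a.1) :
    castLEHom G h x • a = a := by
  have : Equiv.Perm.viaEmbedding x.right (Fin.castLEEmb h) a.1 = a.1 := by
    apply Equiv.Perm.viaEmbedding_apply_of_notMem
    rintro ⟨j, hj⟩
    have := j.2
    rw [← hj] at ha
    simp at ha
    omega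
  refine Prod.ext ?_ ?_
  · simp [smul_def, castLEHom, Equiv.Perm.viaEmbeddingHom_apply, this]
  · simp [smul_def, castLEHom, Equiv.Perm.viaEmbeddingHom_apply, this, not_lt.2 ha]

theorem castLEHom_injective (h : m ≤ n) : Function.Injective (castLEHom G h) := by
  intro x y hxy
  refine ext_smul fun i => ?_
  have h1 := castLEHom_smul_castLE h x i 1
  rw [hxy, castLEHom_smul_castLE] at h1
  have h2 := congrArg Prod.fst h1
  have h3 := congrArg Prod.snd h1
  exact Prod.ext (Fin.castLE_injective h h2).symm h3.symm

theorem inclusion_eq_castLEHom : inclusion G n = castLEHom G n.le_succ := by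
  ext x : 1
  refine SemidirectProduct.ext (funext fun i => ?_) rfl
  refine Fin.lastCases ?_ (fun j => ?_) i
  · rw [inclusion_left_last]
    simp [castLEHom]
  · rw [inclusion_left_castSucc]
    simp [castLEHom]

theorem castLEHom_comp {l : ℕ} (h : l ≤ m) (h' : m ≤ n) :
    (castLEHom G h').comp (castLEHom G h) = castLEHom G (h.trans h') := by
  ext x : 1
  refine ext_smul fun i => ?_
  rw [MonoidHom.comp_apply]
  by_cases him : i.1 < m
  · obtain ⟨j, rfl⟩ : ∃ j : Fin m, j.castLE h' = i := ⟨⟨i, him⟩, rfl⟩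
    rw [castLEHom_smul_castLE]
    by_cases hil : j.1 < l
    · obtain ⟨j, rfl⟩ : ∃ j' : Fin l, j'.castLE h = j := ⟨⟨j, hil⟩, rfl⟩
      rw [castLEHom_smul_castLE]
      exact (castLEHom_smul_castLE (h.trans h') x j 1).symm
    · rw [castLEHom_smul_of_le h x _ (not_lt.1 hil), castLEHom_smul_of_le _ x _ (not_lt.1 hil)]
  · rw [castLEHom_smul_of_le h' _ _ (not_lt.1 him),
      castLEHom_smul_of_le _ _ _ (h.trans (not_lt.1 him))]

theorem mem_range_castLEHom (h : m ≤ n) (x : SymWreath G n)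
    (hx : ∀ i : Fin n, m ≤ i → x • ((i, 1) : Fin n × G) = (i, 1)) :
    x ∈ (castLEHom G h).range := by
  have hfix : ∀ i : Fin n, m ≤ i → x.right i = i := fun i hi => congrArg Prod.fst (hx i hi)
  have hlab : ∀ i : Fin n, m ≤ i → x.left i = 1 := fun i hi => by
    have := congrArg Prod.snd (hx i hi)
    simpa [smul_def, hfix i hi] using this
  have hlt : ∀ σ : Equiv.Perm (Fin n), (∀ i : Fin n, m ≤ i → σ i = i) →
      ∀ i : Fin m, (σ (i.castLE h)).1 < m := by
    intro σ hσ i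
    by_contra! hi
    have h1 := σ.injective (hσ _ hi)
    have := i.2
    rw [h1] at hi
    simp at hi
    omega
  have hfix' : ∀ i : Fin n, m ≤ i → x.right.symm i = i := fun i hi =>
    (Equiv.symm_apply_eq _).2 (hfix i hi).symm
  let σ : Equiv.Perm (Fin m) :=
    { toFun := fun i => ⟨x.right (i.castLE h), hlt _ hfix i⟩
      invFun := fun i => ⟨x.right.symm (i.castLE h), hlt _ hfix' i⟩
      left_inv := fun i => Fin.ext (by
        change (x.right.symm (x.right (i.castLE h))).1 = i
        simp)
      right_inv := fun i => Fin.ext (by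
        change (x.right (x.right.symm (i.castLE h))).1 = i
        simp) }
  refine ⟨⟨fun i => x.left (i.castLE h), σ⟩, ext_smul fun i => ?_⟩
  by_cases him : i.1 < m
  · obtain ⟨j, rfl⟩ : ∃ j : Fin m, j.castLE h = i := ⟨⟨i, him⟩, rfl⟩
    rw [castLEHom_smul_castLE]
    rfl
  · rw [castLEHom_smul_of_le _ _ _ (not_lt.1 him), hx i (not_lt.1 him)]

/-- The words of length `ℓ` in labelled letters with distinct underlying letters. -/
abbrev Word (G : Type u) (n ℓ : ℕ) : Type u :=
  {w : List (Fin n × G) // (w.map Prod.fst).Nodup ∧ w.length = ℓ}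

instance : MulAction (SymWreath G n) (Word G n ℓ) where
  smul x w := ⟨w.1.map (x • ·), by
    constructor
    · have : (w.1.map (x • ·)).map Prod.fst = (w.1.map Prod.fst).map x.right := by
        simp [smul_def, Function.comp_def]
      rw [this]
      exact w.2.1.map x.right.injective
    · simp [w.2.2]⟩
  one_smul w := Subtype.ext <| by
    change w.1.map ((1 : SymWreath G n) • ·) = w.1
    simp
  mul_smul x y w := Subtype.ext <| by
    change w.1.map ((x * y) • ·) = (w.1.map (y • ·)).map (x • ·)
    simp [mul_smul]

theorem coe_smul_word (x : SymWreath G n) (w : Word G n ℓ) :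
    (x • w).1 = w.1.map (x • ·) := rfl

namespace Word

/-- Delete the `i`-th letter. -/
def face (i : Fin (ℓ + 1)) (w : Word G n (ℓ + 1)) : Word G n ℓ :=
  ⟨w.1.eraseIdx i, (w.2.1.sublist ((List.eraseIdx_sublist w.1 i).map _)), by
    rw [List.length_eraseIdx, w.2.2, if_pos i.2, Nat.add_sub_cancel]⟩

theorem face_smul (i : Fin (ℓ + 1)) (x : SymWreath G n) (w : Word G n (ℓ + 1)) :
    face i (x • w) = x • face i w :=
  Subtype.ext (by simp [face, coe_smul_word, List.eraseIdx_map])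

/-- The word `n - 1, n - 2, …, n - ℓ` with trivial labels. -/
def standard (G : Type u) [Group G] (h : ℓ ≤ n) : Word G n ℓ :=
  ⟨List.ofFn fun i : Fin ℓ => (⟨n - 1 - i, by omega⟩, 1), by
    rw [List.map_ofFn, List.nodup_ofFn]
    intro i j hij
    simp at hij
    ext
    omega, by simp⟩

theorem getElem_standard (h : ℓ ≤ n) (i : ℕ) (hi : i < (standard G h).1.length) :
    (standard G h).1[i] = (⟨n - 1 - i, by simp [standard] at hi; omega⟩, 1) := by
  simp only [standard, List.getElem_ofFn]

theorem le_of_mem_standard (h : ℓ ≤ n) {a : Fin n × G} (ha : a ∈ (standard G h).1) :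
    n ≤ a.1 + ℓ := by
  obtain ⟨i, rfl⟩ := (List.mem_ofFn' _ _).1 ha
  simp
  omega

theorem face_last_standard (h : ℓ + 1 ≤ n) :
    face (Fin.last ℓ) (standard G h) = standard G (Nat.le_of_succ_le h) := by
  refine Subtype.ext (List.ext_getElem ?_ fun i h1 h2 => ?_)
  · rw [(face _ _).2.2, (standard _ _).2.2]
  · have : i < ℓ := by rwa [(standard _ _).2.2] at h2
    simp only [face, Fin.val_last, List.getElem_eraseIdx, dif_pos this, getElem_standard]

theorem castLEHom_smul_of_forall (hm : m ≤ n) (w : Word G n ℓ) (hw : ∀ a ∈ w.1, m ≤ a.1)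
    (x : SymWreath G m) : castLEHom G hm x • w = w := by
  refine Subtype.ext ?_
  rw [coe_smul_word]
  conv_rhs => rw [← List.map_id w.1]
  exact List.map_congr_left fun a ha => castLEHom_smul_of_le hm x a (hw a ha)

theorem castLEHom_smul_standard (hm : m ≤ n) (h : ℓ ≤ n) (hml : m + ℓ ≤ n) (x : SymWreath G m) :
    castLEHom G hm x • standard G h = standard G h :=
  castLEHom_smul_of_forall hm _ (fun a ha => by have := le_of_mem_standard h ha; omega) x

theorem mem_range_of_smul_standard (hm : m ≤ n) (h : ℓ ≤ n) (hml : m + ℓ = n)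
    (x : SymWreath G n) (hx : x • standard G h = standard G h) :
    x ∈ (castLEHom G hm).range := by
  refine mem_range_castLEHom hm x fun i hi => ?_
  have hlen : n - 1 - i < (standard G h).1.length := by
    rw [(standard G h).2.2]
    omega
  have h1 : (x • standard G h).1[n - 1 - i]'(by rw [hx]; exact hlen) =
      (standard G h).1[n - 1 - i] := by
    congr 2
  simp only [coe_smul_word, List.getElem_map, getElem_standard] at h1
  have h2 : (⟨n - 1 - (n - 1 - i), by omega⟩ : Fin n) = i := by
    ext
    simp
    omega
  rwa [h2] at h1

theorem exists_smul_standard (h : ℓ ≤ n) (w : Word G n ℓ) :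
    ∃ x : SymWreath G n, x • standard G h = w := by
  let p : Fin ℓ → Fin n := fun i => ⟨n - 1 - i, by omega⟩
  have hp : Function.Injective p := by
    intro i j hij
    simp [p] at hij
    ext
    omega
  let q : Fin ℓ → Fin n := fun i => (w.1[i]'(by rw [w.2.2]; exact i.2)).1
  have hq : Function.Injective q := by
    intro i j hij
    have := (List.Nodup.getElem_inj_iff w.2.1 (i := i) (j := j)
      (hi := by simp [w.2.2]) (hj := by simp [w.2.2])).1 (by simpa [q] using hij)
    exact Fin.ext this
  classical
  let e : {x // x ∈ Set.range p} ≃ {x // x ∈ Set.range q} :=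
    (Equiv.ofInjective p hp).symm.trans (Equiv.ofInjective q hq)
  let σ : Equiv.Perm (Fin n) := e.extendSubtype
  have hσ : ∀ i, σ (p i) = q i := by
    intro i
    rw [Equiv.extendSubtype_apply_of_mem e (p i) ⟨i, rfl⟩]
    simp only [e, Equiv.trans_apply]
    have : (Equiv.ofInjective p hp).symm ⟨p i, ⟨i, rfl⟩⟩ = i := by
      rw [Equiv.symm_apply_eq]
      rfl
    rw [this]
    rfl
  -- The action reads a label at the target letter, so the labels of `w` are placed at its own
  -- letters `q i`.
  let f : Fin n → G :=
    Function.extend q (fun i => (w.1[i]'(by rw [w.2.2]; exact i.2)).2) 1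
  refine ⟨⟨f, σ⟩, Subtype.ext (List.ext_getElem ?_ fun i h1 h2 => ?_)⟩
  · rw [coe_smul_word, List.length_map, w.2.2, (standard G h).2.2]
  · have hi : i < ℓ := by rwa [w.2.2] at h2
    simp only [coe_smul_word, List.getElem_map, getElem_standard, smul_def]
    have h3 : σ ⟨n - 1 - i, by omega⟩ = q ⟨i, hi⟩ := hσ ⟨i, hi⟩
    rw [h3, mul_one]
    exact Prod.ext rfl (hq.extend_apply (fun i => (w.1[i]'(by rw [w.2.2]; exact i.2)).2) 1 ⟨i, hi⟩)

/-- Consecutive faces differ by the transposition of the two letters concerned, both at least `m`;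
it therefore commutes with `G ≀ Σ_m`. -/
theorem exists_commute_face_standard (hm : m ≤ n) (h : ℓ + 1 ≤ n) (hml : m + (ℓ + 1) ≤ n)
    (i : ℕ) (hi : i + 1 < ℓ + 1) :
    ∃ x : SymWreath G n, (∀ y, Commute x (castLEHom G hm y)) ∧
      x • face ⟨i, by omega⟩ (standard G h) = face ⟨i + 1, hi⟩ (standard G h) := by
  let a : Fin n := ⟨n - 1 - i, by omega⟩
  let b : Fin n := ⟨n - 1 - (i + 1), by omega⟩
  let x : SymWreath G n := ⟨1, Equiv.swap a b⟩
  have hx : ∀ c : Fin n × G, x • c = (Equiv.swap a b c.1, c.2) := fun c => by simp [smul_def, x]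
  have hfix : ∀ c : Fin n × G, c.1 ≠ a → c.1 ≠ b → x • c = c := fun c h1 h2 => by
    rw [hx, Equiv.swap_apply_of_ne_of_ne h1 h2]
  have hlow : ∀ c : Fin n × G, c.1.1 < m → x • c = c := fun c hc => by
    apply hfix <;> intro he <;> simp [he, a, b] at hc <;> omega
  refine ⟨x, fun y => ext_smul fun j => ?_, Subtype.ext (List.ext_getElem ?_ fun k h1 h2 => ?_)⟩
  · rw [mul_smul, mul_smul]
    by_cases hj : j.1 < m
    · obtain ⟨j, rfl⟩ : ∃ j' : Fin m, j'.castLE hm = j := ⟨⟨j, hj⟩, rfl⟩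
      rw [hlow (j.castLE hm, 1) hj, castLEHom_smul_castLE]
      exact hlow _ (y • ((j, 1) : Fin m × G)).1.is_lt
    · rw [castLEHom_smul_of_le _ _ _ (not_lt.1 hj), castLEHom_smul_of_le]
      rw [hx]
      simp only [Equiv.swap_apply_def]
      split_ifs
      · simp [b]; omega
      · simp [a]; omega
      · exact not_lt.1 hj
  · rw [coe_smul_word, List.length_map, (face _ _).2.2, (face _ _).2.2]
  · have hk : k < ℓ := by rwa [(face _ _).2.2] at h2
    simp only [coe_smul_word, List.getElem_map, face, List.getElem_eraseIdx]
    rcases lt_trichotomy k i with hki | rfl | hki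
    · rw [dif_pos hki, dif_pos (by omega), getElem_standard]
      apply hfix <;> simp [a, b, Fin.ext_iff] <;> omega
    · rw [dif_neg (lt_irrefl _), dif_pos (by omega), getElem_standard, getElem_standard, hx]
      simp only
      exact Prod.ext (Equiv.swap_apply_right a b) rfl
    · rw [dif_neg (by omega), dif_neg (by omega), getElem_standard]
      apply hfix <;> simp [a, b, Fin.ext_iff] <;> omega

end Word

end SymWreath

/-! ### Homology of a partial resolution, through its image sequences. -/

namespace groupHomology

open Rep Finsupp Limits

section Additive

variable {k G : Type u} [CommRing k] [Group G]

theorem functor_map_add {A B : Rep.{u} k G} (f g : A ⟶ B) (n : ℕ) :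
    (functor k G n).map (f + g) = (functor k G n).map f + (functor k G n).map g := by
  have : chainsMap (MonoidHom.id G) (f + g) =
      chainsMap (MonoidHom.id G) f + chainsMap (MonoidHom.id G) g := by
    ext i x a : 4
    simp [chainsMap_f, Rep.add_hom]
  exact (congrArg (fun t => HomologicalComplex.homologyMap t n) this).trans
    (HomologicalComplex.homologyMap_add _ _ n)

instance (n : ℕ) : (functor k G n).Additive where
  map_add := functor_map_add _ _ n

end Additive

section Resolution

variable {k G : Type u} [CommRing k] [Group G] {C : ℕ → Rep.{u} k G}
  (D : ∀ ℓ, C (ℓ + 1) ⟶ C ℓ)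

/-- The sequence `im D (ℓ + 1) ⟶ C (ℓ + 1) ⟶ im D ℓ`. -/
noncomputable abbrev imageSequence (hD : ∀ ℓ, D (ℓ + 1) ≫ D ℓ = 0) (ℓ : ℕ) :
    ShortComplex (Rep.{u} k G) :=
  ShortComplex.mk (image.ι (D (ℓ + 1))) (factorThruImage (D ℓ)) (by
    rw [← cancel_epi (factorThruImage (D (ℓ + 1))), ← cancel_mono (image.ι (D ℓ))]
    simp [hD])

theorem imageSequence_shortExact (hD : ∀ ℓ, D (ℓ + 1) ≫ D ℓ = 0) {ℓ : ℕ}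
    (h : ∀ x, (D ℓ).hom x = 0 → ∃ y, (D (ℓ + 1)).hom y = x) :
    (imageSequence D hD ℓ).ShortExact := by
  refine shortExact_of_exact ((Rep.mono_iff_injective _).1 inferInstance)
    ((Rep.epi_iff_surjective _).1 inferInstance) fun x hx => ?_
  have hx' : (D ℓ).hom x = 0 := by
    rw [← image.fac (D ℓ)]
    exact (congrArg (image.ι (D ℓ)).hom hx).trans (map_zero _)
  obtain ⟨y, hy⟩ := h x hx'
  refine ⟨(factorThruImage (D (ℓ + 1))).hom y, ?_⟩
  rw [← hy]
  exact congr(($(image.fac (D (ℓ + 1)))).hom y)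

variable {D} (hD : ∀ ℓ, D (ℓ + 1) ≫ D ℓ = 0) {N : ℕ}
  (hex : ∀ ℓ, ℓ + 1 < N → ∀ x, (D ℓ).hom x = 0 → ∃ y, (D (ℓ + 1)).hom y = x)

include hD hex

/-- Injectivity one degree lower forces the connecting map of the image sequence to vanish. -/
theorem epi_map_factorThruImage {ℓ q : ℕ} (hℓ : ℓ + 1 < N)
    (h : ∀ r, r + 1 = q → Mono ((functor k G r).map (image.ι (D (ℓ + 1))))) :
    Epi ((functor k G q).map (factorThruImage (D ℓ))) := by
  have hS := imageSequence_shortExact D hD (hex ℓ hℓ)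
  rcases q with _ | q
  · exact inferInstanceAs (Epi (map (MonoidHom.id G) (factorThruImage (D ℓ)) 0))
  · have := h q rfl
    refine (mapShortComplex₃_exact hS (i := q + 1) (j := q) rfl).epi_f ?_
    have hw := (mapShortComplex₁ hS (i := q + 1) (j := q) rfl).zero
    exact (cancel_mono ((functor k G q).map (image.ι (D (ℓ + 1))))).1 (hw.trans zero_comp.symm)

variable {Q : ℕ}
  (hmono : ∀ q < Q, ∀ ℓ, Even ℓ → 2 * q + ℓ + 2 ≤ N → Mono ((functor k G q).map (D ℓ)))
  (hepi : ∀ q < Q, ∀ ℓ, Even ℓ → 2 * q + ℓ + 1 ≤ N → Epi ((functor k G q).map (D ℓ)))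

include hmono hepi

/-- Classes of `im D_ℓ` lift to `C_(ℓ+1)`. For even `ℓ`, injectivity of `D_ℓ` on homology finishes;
for odd `ℓ`, surjectivity of `D_(ℓ+1)` shows that the homology of `im D_ℓ` vanishes, since `D_ℓ`
kills the image of `D_(ℓ+1)`. -/
theorem mono_map_image_ι (q : ℕ) (hq : q < Q) (ℓ : ℕ) (hN : 2 * q + ℓ + 2 ≤ N) :
    Mono ((functor k G q).map (image.ι (D ℓ))) := by
  induction q using Nat.strong_induction_on generalizing ℓ with
  | _ q ih =>
    have hb := epi_map_factorThruImage hD hex (ℓ := ℓ) (q := q) (by omega)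
      fun r hr => ih r (by omega) (by omega) (ℓ + 1) (by omega)
    have hfac : ∀ ℓ, (functor k G q).map (D ℓ) =
        (functor k G q).map (factorThruImage (D ℓ)) ≫ (functor k G q).map (image.ι (D ℓ)) :=
      fun ℓ => by rw [← Functor.map_comp, image.fac]
    rw [ModuleCat.mono_iff_injective, injective_iff_map_eq_zero]
    intro x hx
    obtain ⟨y, rfl⟩ := (ModuleCat.epi_iff_surjective _).1 hb x
    rw [← ConcreteCategory.comp_apply, ← hfac] at hx
    rcases Nat.even_or_odd ℓ with hℓ | hℓ
    · have := (ModuleCat.mono_iff_injective _).1 (hmono q hq ℓ hℓ hN)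
      rw [this (hx.trans (map_zero _).symm), map_zero]
    · obtain ⟨w, rfl⟩ :=
        (ModuleCat.epi_iff_surjective _).1 (hepi q hq (ℓ + 1) hℓ.add_one (by omega)) y
      have hz : D (ℓ + 1) ≫ factorThruImage (D ℓ) = 0 := by
        rw [← cancel_mono (image.ι (D ℓ)), Category.assoc, image.fac, hD, zero_comp]
      rw [← ConcreteCategory.comp_apply, ← Functor.map_comp, hz, Functor.map_zero]
      rfl

theorem epi_map_zero (h0 : Epi (D 0)) (hN : 2 * Q + 1 ≤ N) :
    Epi ((functor k G Q).map (D 0)) := by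
  rcases Q with _ | Q
  · exact inferInstanceAs (Epi (map (MonoidHom.id G) (D 0) 0))
  · have hb := epi_map_factorThruImage hD hex (ℓ := 0) (q := Q + 1) (by omega)
      fun r hr => mono_map_image_ι hD hex hmono hepi r (by omega) 1 (by omega)
    have : IsIso (image.ι (D 0)) := by
      have := epi_of_epi_fac (image.fac (D 0))
      exact isIso_of_mono_of_epi _
    rw [← image.fac (D 0), Functor.map_comp]
    exact epi_comp _ _

/-- As `im D_0 = C_0`, the kernel on homology is the image of the homology of `im D_1`. That
homology is covered by that of `C_2`, on which the composite to `C_1` is the zero map induced by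
`D_1`. -/
theorem mono_map_zero (h0 : Epi (D 0)) (hodd : (functor k G Q).map (D 1) = 0)
    (hN : 2 * Q + 2 ≤ N) : Mono ((functor k G Q).map (D 0)) := by
  have hb : Epi ((functor k G Q).map (factorThruImage (D 1))) := by
    rcases Q with _ | Q
    · exact inferInstanceAs (Epi (map (MonoidHom.id G) (factorThruImage (D 1)) 0))
    · exact epi_map_factorThruImage hD hex (ℓ := 1) (q := Q + 1) (by omega)
        fun r hr => mono_map_image_ι hD hex hmono hepi r (by omega) 2 (by omega)
  have ha : (functor k G Q).map (image.ι (D 1)) = 0 := by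
    rw [← cancel_epi ((functor k G Q).map (factorThruImage (D 1))), ← Functor.map_comp,
      image.fac, hodd, comp_zero]
  have : IsIso (image.ι (D 0)) := by
    have := epi_of_epi_fac (image.fac (D 0))
    exact isIso_of_mono_of_epi _
  have hm : Mono ((functor k G Q).map (factorThruImage (D 0))) :=
    (mapShortComplex₂_exact (X := imageSequence D hD 0)
      (imageSequence_shortExact D hD (hex 0 (by omega))) Q).mono_g ha
  rw [← image.fac (D 0), Functor.map_comp]
  exact mono_comp _ _

end Resolution

end groupHomology

/-! ### Maps on homology induced by a fixed point. -/

namespace groupHomology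

open Rep Finsupp Limits

section PointMap

variable {k G H : Type u} [CommRing k] [Group G] [Group H] {X Y : Type u} [MulAction G X]
  [MulAction G Y]

/-- The morphism `k[X] ⊗ B ⟶ k[Y] ⊗ B` induced by an equivariant map. -/
noncomputable abbrev finsuppRepMapDomain (B : Rep.{u} k G) (f : X → Y)
    (hf : ∀ (g : G) x, f (g • x) = g • f x) : finsuppRep X B ⟶ finsuppRep Y B :=
  Rep.ofHom ⟨Finsupp.lmapDomain B k f, fun g => by ext x b : 2; simp [hf]⟩

variable (k) in
/-- The morphism `k ⟶ k[X]` given by a point `x` fixed by the image of `ι : H →* G`. -/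
noncomputable abbrev pointHom (ι : H →* G) (x : X) (hx : ∀ h, ι h • x = x) :
    Rep.trivial k H k ⟶ Rep.res ι (finsuppRep X (Rep.trivial k G k)) :=
  Rep.ofHom ⟨Finsupp.lsingle x, fun h => by ext; simp [hx]⟩

variable (k) in
/-- The map `H_n(H; k) ⟶ H_n(G; k[X])` induced by a homomorphism `ι : H →* G` and a point fixed
by its image. -/
noncomputable abbrev pointMap (ι : H →* G) (x : X) (hx : ∀ h, ι h • x = x) (n : ℕ) :
    groupHomology (Rep.trivial k H k) n ⟶
      (functor k G n).obj (finsuppRep X (Rep.trivial k G k)) :=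
  map ι (pointHom k ι x hx) n

theorem isIso_pointMap (ι : H →* G) (x : X) (hx : ∀ h, ι h • x = x)
    (hinj : Function.Injective ι) (htrans : ∀ y : X, ∃ g : G, g • x = y)
    (hstab : ∀ g : G, g • x = x → g ∈ ι.range) (n : ℕ) : IsIso (pointMap k ι x hx n) :=
  isIso_map_singleHom ι x hx hinj htrans hstab (Rep.trivial k G k) n

theorem pointMap_comp_mapDomain (ι : H →* G) (x : X) (hx : ∀ h, ι h • x = x) (n : ℕ)
    (f : X → Y) (hf : ∀ (g : G) x, f (g • x) = g • f x) :
    pointMap k ι x hx n ≫ (functor k G n).map (finsuppRepMapDomain (Rep.trivial k G k) f hf) =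
      pointMap k ι (f x) (fun h => by rw [← hf, hx]) n := by
  refine (map_comp ι (MonoidHom.id G) _ _ n).symm.trans (map_congr rfl ?_ n)
  ext
  simp

/-- Conjugation by `g` fixes `ι` and moves `x` to `g • x`, and it acts trivially on homology. -/
theorem pointMap_smul (ι : H →* G) (x : X) (hx : ∀ h, ι h • x = x) (g : G)
    (hg : ∀ h, Commute g (ι h)) (n : ℕ) :
    pointMap k ι (g • x) (fun h => by rw [smul_smul, ← (hg h).eq, mul_smul, hx]) n =
      pointMap k ι x hx n := by
  refine Eq.trans ?_ ((map_comp ι (MulAut.conj g).toMonoidHom (pointHom k ι x hx)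
    (conjHom g (finsuppRep X (Rep.trivial k G k))) n).trans ?_)
  · refine map_congr ?_ ?_ n
    · ext h
      simp [(hg h).eq]
    · exact LinearMap.ext_ring (finsuppRep_ρ_single X (Rep.trivial k G k) g x (1 : k)).symm
  · rw [map_conj]
    exact Category.comp_id _

theorem map_comp_pointMap {H' : Type u} [Group H'] (ι : H →* G) (x : X)
    (hx : ∀ h, ι h • x = x) (f : H' →* H) (n : ℕ) :
    map (A := Rep.trivial k H' k) (B := Rep.trivial k H k) f (𝟙 (Rep.trivial k H' k)) n ≫
      pointMap k ι x hx n = pointMap k (ι.comp f) x (fun h => hx (f h)) n :=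
  (map_comp f ι (B := Rep.trivial k H k) (𝟙 (Rep.trivial k H' k)) (pointHom k ι x hx)
    n).symm.trans (map_congr rfl rfl n)

end PointMap

end groupHomology

section Square

variable {C : Type*} [Category* C] {X Y X' Y' : C} {a : X ⟶ X'} {b : Y ⟶ Y'} {f : X' ⟶ Y'}
  {g : X ⟶ Y} [IsIso a] [IsIso b]

theorem mono_iff_of_square (h : a ≫ f = g ≫ b) : Mono f ↔ Mono g := by
  constructor
  · intro
    have hg : g = a ≫ f ≫ inv b := by simp [reassoc_of% h]
    rw [hg]
    infer_instance
  · intro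
    have hf : f = inv a ≫ g ≫ b := by simp [← h]
    rw [hf]
    infer_instance

theorem epi_iff_of_square (h : a ≫ f = g ≫ b) : Epi f ↔ Epi g := by
  constructor
  · intro
    have hg : g = a ≫ f ≫ inv b := by simp [reassoc_of% h]
    rw [hg]
    infer_instance
  · intro
    have hf : f = inv a ≫ g ≫ b := by simp [← h]
    rw [hf]
    infer_instance

end Square

/-! ### The differential as stabilization, and the induction. -/

namespace SymWreath

open groupHomology

variable (G : Type u) (n : ℕ)

/-- Chains of injective words as chains of words. -/
noncomputable abbrev toChains (ℓ : ℕ) :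
    (Word G n ℓ →₀ ULift.{u} ℤ) →ₗ[ULift.{u} ℤ] (List (Fin n × G) →₀ ULift.{u} ℤ) :=
  Finsupp.lmapDomain _ _ Subtype.val

variable {G n}

theorem toChains_injective (ℓ : ℕ) : Function.Injective (toChains G n ℓ) :=
  Finsupp.mapDomain_injective Subtype.val_injective

theorem toChains_mem (ℓ : ℕ) (z : Word G n ℓ →₀ ULift.{u} ℤ) :
    toChains G n ℓ z ∈ Finsupp.supported (ULift.{u} ℤ) (ULift.{u} ℤ)
      {w | InjectiveWords.IsInjectiveOver Finset.univ w ∧ w.length = ℓ} := by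
  induction z using Finsupp.induction_linear with
  | zero => simp
  | add x y hx hy => rw [map_add]; exact Submodule.add_mem _ hx hy
  | single w r =>
    rw [Finsupp.lmapDomain_apply, Finsupp.mapDomain_single]
    exact Finsupp.single_mem_supported _ _ ⟨⟨w.2.1, by simp⟩, w.2.2⟩

theorem exists_toChains_eq (ℓ : ℕ) {y : List (Fin n × G) →₀ ULift.{u} ℤ}
    (hy : y ∈ Finsupp.supported (ULift.{u} ℤ) (ULift.{u} ℤ)
      {w | InjectiveWords.IsInjectiveOver Finset.univ w ∧ w.length = ℓ}) :
    ∃ z, toChains G n ℓ z = y := by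
  rw [Finsupp.supported_eq_span_single] at hy
  induction hy using Submodule.span_induction with
  | mem x hx =>
    obtain ⟨w, hw, rfl⟩ := hx
    exact ⟨Finsupp.single ⟨w, hw.1.1, hw.2⟩ 1, Finsupp.mapDomain_single⟩
  | zero => exact ⟨0, map_zero _⟩
  | add x y _ _ hx hy =>
    obtain ⟨x', rfl⟩ := hx
    obtain ⟨y', rfl⟩ := hy
    exact ⟨x' + y', map_add _ _ _⟩
  | smul r x _ hx =>
    obtain ⟨x', rfl⟩ := hx
    exact ⟨r • x', map_smul _ _ _⟩

variable (G n) [Group G]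

/-- The `ℓ`-th term of the complex of injective words. -/
noncomputable abbrev wordRep (ℓ : ℕ) : Rep.{u} (ULift.{u} ℤ) (SymWreath G n) :=
  finsuppRep (Word G n ℓ) (Rep.trivial (ULift.{u} ℤ) (SymWreath G n) (ULift.{u} ℤ))

/-- The map deleting the `i`-th letter. -/
noncomputable abbrev faceHom (ℓ : ℕ) (i : Fin (ℓ + 1)) : wordRep G n (ℓ + 1) ⟶ wordRep G n ℓ :=
  finsuppRepMapDomain _ (Word.face i) (Word.face_smul i)

/-- The differential of the complex of injective words. -/
noncomputable def wordD (ℓ : ℕ) : wordRep G n (ℓ + 1) ⟶ wordRep G n ℓ :=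
  ∑ i : Fin (ℓ + 1), (-1 : ℤ) ^ (i : ℕ) • faceHom G n ℓ i

variable {G n}

theorem toChains_wordD (ℓ : ℕ) (z : Word G n (ℓ + 1) →₀ ULift.{u} ℤ) :
    toChains G n ℓ ((wordD G n ℓ).hom z) =
      InjectiveWords.boundary (ULift.{u} ℤ) (toChains G n (ℓ + 1) z) := by
  induction z using Finsupp.induction_linear with
  | zero => exact (map_zero (toChains G n ℓ ∘ₗ (wordD G n ℓ).hom.toLinearMap)).trans (by simp)
  | add x y hx hy =>
    refine (map_add (toChains G n ℓ ∘ₗ (wordD G n ℓ).hom.toLinearMap) x y).trans ?_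
    rw [map_add, map_add, ← hx, ← hy]
    rfl
  | single w r =>
    have h1 : (wordD G n ℓ).hom (Finsupp.single w r) =
        ∑ i : Fin (ℓ + 1), (-1 : ℤ) ^ (i : ℕ) • Finsupp.single (Word.face i w) r := by
      let ev : (wordRep G n (ℓ + 1) ⟶ wordRep G n ℓ) →+ (Word G n ℓ →₀ ULift.{u} ℤ) :=
        AddMonoidHom.mk' (fun f => f.hom (Finsupp.single w r)) fun _ _ => rfl
      change ev (wordD G n ℓ) = _
      rw [wordD, map_sum]
      refine Finset.sum_congr rfl fun i _ => ?_
      rw [map_zsmul]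
      congr 1
      exact Finsupp.mapDomain_single
    rw [h1]
    simp only [map_sum, map_zsmul, Finsupp.lmapDomain_apply, Finsupp.mapDomain_single,
      InjectiveWords.boundary_single, InjectiveWords.boundaryWord_eq_sum, w.2.2]
    rw [Finset.sum_range, Finset.smul_sum]
    refine Finset.sum_congr rfl fun i _ => ?_
    rw [Finsupp.smul_single, Finsupp.smul_single]
    congr 1
    rw [zsmul_eq_mul, smul_eq_mul, mul_comm]
    push_cast
    rfl

theorem wordD_comp_wordD (ℓ : ℕ) : wordD G n (ℓ + 1) ≫ wordD G n ℓ = 0 := by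
  ext1
  refine Representation.IntertwiningMap.ext (LinearMap.ext fun z => toChains_injective ℓ ?_)
  refine (toChains_wordD ℓ _).trans ?_
  refine (congrArg _ (toChains_wordD (ℓ + 1) z)).trans ?_
  rw [InjectiveWords.boundary_boundary]
  exact (map_zero _).symm

/-- The complex of injective words is exact in lengths below `n`. -/
theorem exists_wordD_eq {ℓ : ℕ} (hℓ : ℓ < n) (z : Word G n ℓ →₀ ULift.{u} ℤ)
    (hz : InjectiveWords.boundary (ULift.{u} ℤ) (toChains G n ℓ z) = 0) :
    ∃ y, (wordD G n ℓ).hom y = z := by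
  have : Nonempty (Fin n) := ⟨⟨ℓ, hℓ⟩⟩
  obtain ⟨y, hy, hyz⟩ := InjectiveWords.exists_boundary_eq (Finset.univ : Finset (Fin n))
    (by simpa using hℓ) (toChains_mem ℓ z) hz
  obtain ⟨y, rfl⟩ := exists_toChains_eq _ hy
  exact ⟨y, toChains_injective ℓ ((toChains_wordD ℓ y).trans hyz)⟩

theorem wordD_exact {ℓ : ℕ} (hℓ : ℓ + 1 < n) (z : wordRep G n (ℓ + 1))
    (hz : (wordD G n ℓ).hom z = 0) : ∃ y, (wordD G n (ℓ + 1)).hom y = z := by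
  refine exists_wordD_eq hℓ z ?_
  rw [← toChains_wordD]
  exact (congrArg _ hz).trans (map_zero _)

/-- Every chain in length `0` is a cycle, so exactness there is surjectivity. -/
theorem epi_wordD_zero (hn : 0 < n) : Epi (wordD G n 0) := by
  rw [Rep.epi_iff_surjective]
  intro z
  refine exists_wordD_eq hn z ?_
  have h : ∀ w : Word G n 0, w.1 = [] := fun w => List.length_eq_zero_iff.1 w.2.2
  induction z using Finsupp.induction_linear with
  | zero => simp
  | add x y hx hy => rw [map_add, map_add, hx, hy, add_zero]
  | single w r => simp [h, InjectiveWords.boundaryWord]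

section Shapiro

variable {m ℓ : ℕ}

variable (G) in
/-- The Shapiro map `H_q(G ≀ Σ_m) ⟶ H_q(G ≀ Σ_n; k[words of length ℓ])`, for `m + ℓ = n`. -/
noncomputable abbrev shapiroMap (h : m + ℓ = n) (q : ℕ) :
    integralHomology (SymWreath G m) q ⟶ (functor _ _ q).obj (wordRep G n ℓ) :=
  pointMap (ULift.{u} ℤ) (castLEHom G (by omega)) (Word.standard G (ℓ := ℓ) (n := n) (by omega))
    (Word.castLEHom_smul_standard _ _ h.le) q

theorem isIso_shapiroMap (h : m + ℓ = n) (q : ℕ) : IsIso (shapiroMap G h q) :=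
  isIso_pointMap _ _ _ (castLEHom_injective _) (Word.exists_smul_standard _)
    (Word.mem_range_of_smul_standard _ _ h) q

theorem pointMap_congr {X Γ H : Type u} [Group Γ] [Group H] [MulAction Γ X] {ι ι' : H →* Γ}
    {x x' : X} (hι : ι = ι') (hxx : x = x') (hx : ∀ h, ι h • x = x) (hx' : ∀ h, ι' h • x' = x')
    (q : ℕ) : pointMap (ULift.{u} ℤ) ι x hx q = pointMap (ULift.{u} ℤ) ι' x' hx' q := by
  subst hι hxx
  rfl

theorem shapiroMap_comp_faceHom (h : m + (ℓ + 1) = n) (q : ℕ) (i : Fin (ℓ + 1)) :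
    shapiroMap G h q ≫ (functor _ _ q).map (faceHom G n ℓ i) =
      integralHomologyMap (inclusion G m) q ≫
        shapiroMap G (m := m + 1) (ℓ := ℓ) (by omega) q := by
  -- All faces are compared with the last one, which deletes the smallest letter of the standard
  -- word and leaves the standard word of length `ℓ`.
  have key : ∀ j : ℕ, ∀ hj : j ≤ ℓ,
      shapiroMap G h q ≫ (functor _ _ q).map (faceHom G n ℓ ⟨ℓ - j, by omega⟩) =
      shapiroMap G h q ≫ (functor _ _ q).map (faceHom G n ℓ (Fin.last ℓ)) := by
    intro j
    induction j with
    | zero => exact fun _ => rfl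
    | succ j ih =>
      intro hj
      rw [← ih (by omega), pointMap_comp_mapDomain, pointMap_comp_mapDomain]
      obtain ⟨x, hx, hxw⟩ := Word.exists_commute_face_standard (G := G) (m := m) (by omega)
        (by omega : ℓ + 1 ≤ n) h.le (ℓ - (j + 1)) (by omega)
      rw [← pointMap_smul _ _ _ x hx]
      refine pointMap_congr rfl (hxw.trans ?_) _ _ q
      congr 2
      omega
  have hi : i = ⟨ℓ - (ℓ - i), by omega⟩ := by ext; simp; omega
  rw [hi, key _ (by omega), pointMap_comp_mapDomain]
  refine Eq.trans ?_ (map_comp_pointMap _ _ _ _ q).symm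
  refine pointMap_congr ?_ (Word.face_last_standard _) _ _ q
  rw [inclusion_eq_castLEHom, castLEHom_comp]

theorem shapiroMap_comp_wordD (h : m + (ℓ + 1) = n) (q : ℕ) :
    shapiroMap G h q ≫ (functor _ _ q).map (wordD G n ℓ) =
      (if Even ℓ then (1 : ℤ) else 0) • (integralHomologyMap (inclusion G m) q ≫
        shapiroMap G (m := m + 1) (ℓ := ℓ) (by omega) q) := by
  have hsum : ∑ i : Fin (ℓ + 1), (-1 : ℤ) ^ (i : ℕ) = if Even ℓ then 1 else 0 := by
    rw [← Finset.sum_range (fun i => (-1 : ℤ) ^ i), neg_one_geom_sum]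
    simp only [Nat.even_add_one]
    split_ifs <;> rfl
  rw [wordD, Functor.map_sum, Preadditive.comp_sum, ← hsum, Finset.sum_smul]
  refine Finset.sum_congr rfl fun i _ => ?_
  rw [Functor.map_zsmul, Preadditive.comp_zsmul, shapiroMap_comp_faceHom]

theorem map_wordD_of_odd (h : ℓ + 1 ≤ n) (hℓ : ¬Even ℓ) (q : ℕ) :
    (functor _ _ q).map (wordD G n ℓ) = 0 := by
  have hm : (n - (ℓ + 1)) + (ℓ + 1) = n := by omega
  have := isIso_shapiroMap (G := G) hm q
  rw [← cancel_epi (shapiroMap G hm q), shapiroMap_comp_wordD, if_neg hℓ, zero_smul,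
    Limits.comp_zero]

theorem map_wordD_of_even (h : m + (ℓ + 1) = n) (hℓ : Even ℓ) (q : ℕ) :
    shapiroMap G h q ≫ (functor _ _ q).map (wordD G n ℓ) =
      integralHomologyMap (inclusion G m) q ≫
        shapiroMap G (m := m + 1) (ℓ := ℓ) (by omega) q := by
  rw [shapiroMap_comp_wordD, if_pos hℓ, one_smul]

theorem mono_map_wordD_iff (h : m + (ℓ + 1) = n) (hℓ : Even ℓ) (q : ℕ) :
    Mono ((functor _ _ q).map (wordD G n ℓ)) ↔ Mono (integralHomologyMap (inclusion G m) q) := by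
  have h1 := isIso_shapiroMap (G := G) h q
  have h2 := isIso_shapiroMap (G := G) (m := m + 1) (ℓ := ℓ) (n := n) (by omega) q
  exact mono_iff_of_square (map_wordD_of_even h hℓ q)

theorem epi_map_wordD_iff (h : m + (ℓ + 1) = n) (hℓ : Even ℓ) (q : ℕ) :
    Epi ((functor _ _ q).map (wordD G n ℓ)) ↔ Epi (integralHomologyMap (inclusion G m) q) := by
  have h1 := isIso_shapiroMap (G := G) h q
  have h2 := isIso_shapiroMap (G := G) (m := m + 1) (ℓ := ℓ) (n := n) (by omega) q
  exact epi_iff_of_square (map_wordD_of_even h hℓ q)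

end Shapiro

theorem homological_stability (i : ℕ) : ∀ n : ℕ,
    (2 * i ≤ n → Epi (integralHomologyMap (inclusion G n) i)) ∧
    (2 * i + 1 ≤ n → Mono (integralHomologyMap (inclusion G n) i)) := by
  induction i using Nat.strong_induction_on with
  | _ Q ih =>
    intro n
    -- For words on `n + 1` letters, an even `D_ℓ` is stabilization from `n - ℓ`; the bound becomes
    -- the inductive range `2 * q + 1 ≤ n - ℓ`.
    have hm : ∀ q < Q, ∀ ℓ, Even ℓ → 2 * q + ℓ + 2 ≤ n + 1 →
        Mono ((functor _ _ q).map (wordD G (n + 1) ℓ)) := fun q hq ℓ hℓ hN =>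
      (mono_map_wordD_iff (m := n - ℓ) (by omega) hℓ q).2 ((ih q hq (n - ℓ)).2 (by omega))
    have he : ∀ q < Q, ∀ ℓ, Even ℓ → 2 * q + ℓ + 1 ≤ n + 1 →
        Epi ((functor _ _ q).map (wordD G (n + 1) ℓ)) := fun q hq ℓ hℓ hN =>
      (epi_map_wordD_iff (m := n - ℓ) (by omega) hℓ q).2 ((ih q hq (n - ℓ)).1 (by omega))
    have h0 := epi_wordD_zero (G := G) n.succ_pos
    have hex : ∀ ℓ, ℓ + 1 < n + 1 → ∀ x, (wordD G (n + 1) ℓ).hom x = 0 →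
        ∃ y, (wordD G (n + 1) (ℓ + 1)).hom y = x := fun ℓ hℓ x hx => wordD_exact hℓ x hx
    constructor
    · intro hn
      rw [← epi_map_wordD_iff (ℓ := 0) (n := n + 1) rfl (by simp)]
      exact epi_map_zero wordD_comp_wordD hex hm he h0 (by omega)
    · intro hn
      rw [← mono_map_wordD_iff (ℓ := 0) (n := n + 1) rfl (by simp)]
      exact mono_map_zero wordD_comp_wordD hex hm he h0
        (map_wordD_of_odd (by omega) (by simp) Q) (by omega)

end SymWreath

theorem proposition1p5 {G : Type u} [Group G] (n i : ℕ) :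
    (2 * i + 1 ≤ n →
      Function.Bijective (integralHomologyMap (SymWreath.inclusion G n) i)) ∧
    (n = 2 * i →
      Function.Surjective (integralHomologyMap (SymWreath.inclusion G n) i)) := by
  obtain ⟨hepi, hmono⟩ := SymWreath.homological_stability (G := G) i n
  exact ⟨fun h => ⟨(ModuleCat.mono_iff_injective _).1 (hmono h),
    (ModuleCat.epi_iff_surjective _).1 (hepi (by omega))⟩,
    fun h => (ModuleCat.epi_iff_surjective _).1 (hepi h.ge)⟩
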